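/- Let $0<\delta\le 1$ and $q=2+\delta$. For every $n$ let $X_1,X_2,\dots$ (depending on $n$) be i.i.d. random vectors in $\mathbb{R}^{p}$, $p=p_n$, with mean $0$, $\mathbb{E}|X_1|^2<\infty$ and covariance matrix $\Sigma=\Sigma_n\neq 0$ with eigenvalues $\lambda_1,\dots,\lambda_p$ (counted with multiplicity). Put $f=(\mathrm{tr}\,\Sigma^2)^{1/2}$, $$\tilde R_n=\frac{\sum_{1\le i\ne j\le n}X_i^TX_j}{(n-1)f},\qquad V=\sum_{j=1}^p\frac{\lambda_j}{f}(\eta_j-1),$$ where $\eta_1,\dots,\eta_p$ are i.i.d. $\chi^2_1$ random variables. Assume that $$D_\delta^{q}:=\mathbb{E}\left|\frac{X_1^TX_2}{f}\right|^{q}<\infty\quad\text{for every } n,$$ let $\tilde D_\delta=D_\delta+d_\delta$ with $d_\delta=(1+\delta)^{1/2}(\mathbb{E}|\xi|^{q})^{2/q}$, $\xi\sim N(0,1)$, and assume further that $$L^\dagger_\delta:=\frac{\mathbb{E}(X_1^T\Sigma X_1)^{q/2}}{n^{\delta/2}f^q}+\frac{\tilde D_\delta^q}{n^\delta}\to 0\qquad\text{as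 } n\to\infty.$$ Then $\psi_n:=(L^\dagger_\delta)^{-1/(q+1/2)}\to\infty$ and $$\sup_{t\in\mathbb{R}}\left|\mathbb{P}(\tilde R_n\le t)-\mathbb{P}(V\le t)\right|=O(\psi_n^{-1/2})\to 0\qquad\text{as } n\to\infty.$$ -/

import Mathlib

open MeasureTheory ProbabilityTheory Filter Asymptotics
open scoped Topology Matrix

namespace UStat

noncomputable section

/-- The covariance matrix of a random vector `X` in `ℝᵖ`. -/
def covMatrix {Ω : Type*} [MeasurableSpace Ω] {p : ℕ}
    (X : Ω → EuclideanSpace ℝ (Fin p)) (μ : Measure Ω) : Matrix (Fin p) (Fin p) ℝ :=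
  Matrix.of fun j k => cov[fun ω => X ω j, fun ω => X ω k; μ]

theorem covMatrix_isHermitian {Ω : Type*} [MeasurableSpace Ω] {p : ℕ}
    (X : Ω → EuclideanSpace ℝ (Fin p)) (μ : Measure Ω) : (covMatrix X μ).IsHermitian := by
  ext j k
  simp [covMatrix, Matrix.conjTranspose_apply, covariance_comm]

/-- `f = (tr Σ²)^{1/2}`, the Frobenius norm of the covariance matrix `Σ` of `X`. -/
def frob {Ω : Type*} [MeasurableSpace Ω] {p : ℕ}
    (X : Ω → EuclideanSpace ℝ (Fin p)) (μ : Measure Ω) : ℝ :=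
  Real.sqrt ((covMatrix X μ ^ 2).trace)

/-- The `χ²₁` distribution: the law of the square of a standard normal variable. -/
def chiSqOne : Measure ℝ := (gaussianReal 0 1).map fun x => x ^ 2

/-- The law of `V = ∑ⱼ (λⱼ / f) (ηⱼ - 1)`, where `λ₁, …, λ_p` are the eigenvalues (with
multiplicity) of the covariance matrix of `X` and the `ηⱼ` are i.i.d. `χ²₁`. -/
def lawV {Ω : Type*} [MeasurableSpace Ω] {p : ℕ}
    (X : Ω → EuclideanSpace ℝ (Fin p)) (μ : Measure Ω) : Measure ℝ :=
  (Measure.pi fun _ : Fin p => chiSqOne).map fun η =>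
    ∑ j : Fin p, (covMatrix_isHermitian X μ).eigenvalues j / frob X μ * (η j - 1)

/-- The constant `d_δ = (1 + δ)^{1/2} ‖ξ‖²_{2+δ}` with `ξ ∼ N(0, 1)`. -/
def dConst (δ : ℝ) : ℝ :=
  Real.sqrt (1 + δ) * ((∫ x, |x| ^ (2 + δ) ∂(gaussianReal 0 1)) ^ (1 / (2 + δ))) ^ 2

/-- `D_δ = ‖X₁ᵀ X₂ / f‖_{2+δ}`. -/
def DConst {Ω : Type*} [MeasurableSpace Ω] {p : ℕ} (δ : ℝ)
    (X₁ X₂ : Ω → EuclideanSpace ℝ (Fin p)) (μ : Measure Ω) : ℝ :=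
  (∫ ω, |inner ℝ (X₁ ω) (X₂ ω) / frob X₁ μ| ^ (2 + δ) ∂μ) ^ (1 / (2 + δ))

/-- `L†_δ = E (X₁ᵀ Σ X₁)^{q/2} / (n^{δ/2} f^q) + (D_δ + d_δ)^q / n^δ`, where `q = 2 + δ`. -/
def Ldagger {Ω : Type*} [MeasurableSpace Ω] {p : ℕ} (δ : ℝ) (n : ℕ)
    (X₁ X₂ : Ω → EuclideanSpace ℝ (Fin p)) (μ : Measure Ω) : ℝ :=
  (∫ ω, ((X₁ ω).ofLp ⬝ᵥ (covMatrix X₁ μ *ᵥ (X₁ ω).ofLp)) ^ ((2 + δ) / 2) ∂μ)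
      / ((n : ℝ) ^ (δ / 2) * frob X₁ μ ^ (2 + δ))
    + (DConst δ X₁ X₂ μ + dConst δ) ^ (2 + δ) / (n : ℝ) ^ δ

/-- `ψ_n = (L†_δ)^{-1/(q + 1/2)}`, where `q = 2 + δ`. -/
def psi {Ω : Type*} [MeasurableSpace Ω] {p : ℕ} (δ : ℝ) (n : ℕ)
    (X₁ X₂ : Ω → EuclideanSpace ℝ (Fin p)) (μ : Measure Ω) : ℝ :=
  Ldagger δ n X₁ X₂ μ ^ (-1 / (2 + δ + 1 / 2))

/-- `R̃_n = ∑_{i ≠ j} Xᵢᵀ Xⱼ / ((n - 1) f)`, the sum being over the first `n` vectors of the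
sequence, which is indexed from `0`. -/
def Rtilde {Ω : Type*} [MeasurableSpace Ω] {p : ℕ} (n : ℕ)
    (X : ℕ → Ω → EuclideanSpace ℝ (Fin p)) (μ : Measure Ω) (ω : Ω) : ℝ :=
  (∑ i ∈ Finset.range n, ∑ j ∈ Finset.range n with i ≠ j, inner ℝ (X i ω) (X j ω))
    / (((n : ℝ) - 1) * frob (X 0) μ)

/-- The Kolmogorov distance `sup_t |P(R̃_n ≤ t) - P(V ≤ t)|`. -/
def kolmogorovDist {Ω : Type*} [MeasurableSpace Ω] {p : ℕ} (n : ℕ)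
    (X : ℕ → Ω → EuclideanSpace ℝ (Fin p)) (μ : Measure Ω) : ℝ :=
  ⨆ t : ℝ, |μ.real {ω | Rtilde n X μ ω ≤ t} - (lawV (X 0) μ).real (Set.Iic t)|

end

end UStat

namespace UStat

set_option linter.unusedSectionVars false

/-! ### Analytic preliminaries -/

/-! The proof is a Lindeberg replacement at the level of quadratic forms. With `W = ∑ Xᵢ`, the
statistic is `(|W|² - ∑ |Xᵢ|²) / ((n - 1) f)`, a function of the sum of the i.i.d. pairs `(Xᵢ,
|Xᵢ|²)`. Adding one pair `(x, |x|²)` to `(w, r)` changes `|w|² - r` by `2⟨w, x⟩`, which is linear in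
`x`. A second-order Taylor expansion of a smooth test function therefore involves only the mean and
covariance of `x`, and replacing `x` by a centred Gaussian vector with the same covariance costs
only the remainder, of order `E |⟨W', X⟩|^q / (n f)^q`, where `W'` is the sum of the other summands.
For fixed `x`, `⟨W', x⟩` is a sum of independent centred real variables, so a Rosenthal inequality
bounds this moment by the two quantities in `L†`. The moments involving Gaussian vectors are
multiples of `E (XᵀΣX)^{q/2}` at most (`abs_integral_quadTest_convPow_sub_le`,
`lindeberg_constant_le`).

For Gaussian summands, `(|W|²/n - tr Σ)/f` has exactly the law of `V`, and the statistic differs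
from it by `O(n^{-1/2})` in mean (`abs_integral_quadTest_gauss_sub_le`).

Passing from smooth test functions of width `1/ψ` to distribution functions requires concentration
of `V`. Its characteristic function is at most `|u|^{-1/2}` in modulus in every dimension, so an
interval of length of order `h` has probability `O(h^{1/2})` (`exists_chiSum_concentration`). The
total error is of order `ψ^q L + ψ/√n + ψ^{-1/2}` for any `ψ > 0` (`exists_kolmogorov_bound`). The
choice `ψ = L^{-1/(q+1/2)}` equates the outer terms, and `d_δ ≥ 1` forces `L ≥ n^{-δ}`, which makes
the middle one no larger. -/

theorem abs_le_of_hasDerivAt_of_abs_le {h h' : ℝ → ℝ} {C : ℝ} (m : ℕ) (h0 : h 0 = 0)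
    (hC : 0 ≤ C) (hd : ∀ y, HasDerivAt h (h' y) y) (hb : ∀ y, |h' y| ≤ C * |y| ^ m) (y : ℝ) :
    |h y| ≤ C * |y| ^ (m + 1) := by
  have key := (convex_uIcc (0 : ℝ) y).norm_image_sub_le_of_norm_hasDerivWithin_le
    (f := h) (f' := h') (C := C * |y| ^ m) (fun x _ => (hd x).hasDerivWithinAt)
    (fun x hx => by
      rw [Real.norm_eq_abs]
      refine (hb x).trans ?_
      have : |x| ≤ |y| := by simpa using Set.abs_sub_left_of_mem_uIcc hx
      gcongr) Set.left_mem_uIcc Set.right_mem_uIcc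
  simpa [h0, pow_succ, mul_assoc] using key

/-- For `|y| ≤ 1` the cubic remainder is dominated by `|y|^q` because `q ≤ 3`. For `|y| ≥ 1` the
quadratic remainder and the quadratic term itself are each dominated by `|y|^q` because `q ≥ 2`. -/
theorem abs_taylor_two_le {φ φ₁ φ₂ φ₃ : ℝ → ℝ} {K : ℝ} (h1 : ∀ x, HasDerivAt φ (φ₁ x) x)
    (h2 : ∀ x, HasDerivAt φ₁ (φ₂ x) x) (h3 : ∀ x, HasDerivAt φ₂ (φ₃ x) x)
    (hK2 : ∀ x, |φ₂ x| ≤ K) (hK3 : ∀ x, |φ₃ x| ≤ K) {q : ℝ} (hq : 2 ≤ q) (hq' : q ≤ 3)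
    (a y : ℝ) : |φ (a + y) - φ a - φ₁ a * y - φ₂ a / 2 * y ^ 2| ≤ 2 * K * |y| ^ q := by
  have hK : 0 ≤ K := (abs_nonneg _).trans (hK2 0)
  have sh : ∀ {ψ ψ' : ℝ → ℝ}, (∀ x, HasDerivAt ψ (ψ' x) x) → ∀ z,
      HasDerivAt (fun z => ψ (a + z)) (ψ' (a + z)) z := fun {ψ ψ'} h z => by
    simpa using (h (a + z)).comp_const_add a z
  rcases le_total |y| 1 with hy | hy
  · have e2 := abs_le_of_hasDerivAt_of_abs_le (h := fun z => φ₂ (a + z) - φ₂ a) 0 (by simp) hK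
      (fun z => (sh h3 z).sub_const _) (by simpa using fun z => hK3 (a + z))
    have e1 := abs_le_of_hasDerivAt_of_abs_le (h := fun z => φ₁ (a + z) - φ₁ a - φ₂ a * z) 1
      (by simp) hK (fun z => by
        convert! ((sh h2 z).sub_const (φ₁ a)).sub ((hasDerivAt_id z).const_mul (φ₂ a)) using 1
        simp) e2
    have e0 := abs_le_of_hasDerivAt_of_abs_le
      (h := fun z => φ (a + z) - φ a - φ₁ a * z - φ₂ a / 2 * z ^ 2) 2
      (by simp) hK (fun z => by
        convert! (((sh h1 z).sub_const _).sub ((hasDerivAt_id z).const_mul (φ₁ a))).sub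
          ((hasDerivAt_pow 2 z).const_mul (φ₂ a / 2)) using 1
        simp; ring) e1 y
    refine e0.trans ?_
    have : |y| ^ 3 ≤ |y| ^ q := by
      rw [← Real.rpow_natCast]
      rcases (abs_nonneg y).eq_or_lt with h | h
      · rw [← h, Real.zero_rpow (by norm_num), Real.zero_rpow (by linarith)]
      · exact Real.rpow_le_rpow_of_exponent_ge h hy (by norm_num; linarith)
    have h4 := mul_le_mul_of_nonneg_left this hK
    have : 0 ≤ K * |y| ^ q := by positivity
    norm_num at h4 ⊢
    linarith
  · have e1 := abs_le_of_hasDerivAt_of_abs_le (h := fun z => φ₁ (a + z) - φ₁ a) 0 (by simp) hK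
      (fun z => (sh h2 z).sub_const _) (by simpa using fun z => hK2 (a + z))
    have e0 := abs_le_of_hasDerivAt_of_abs_le (h := fun z => φ (a + z) - φ a - φ₁ a * z) 1
      (by simp) hK (fun z => by
        convert! ((sh h1 z).sub_const (φ a)).sub ((hasDerivAt_id z).const_mul (φ₁ a)) using 1
        simp) e1 y
    have h5 : |φ₂ a / 2 * y ^ 2| ≤ K * |y| ^ 2 := by
      rw [abs_mul, abs_pow, abs_div]
      have := hK2 a
      have h2 : |(2 : ℝ)| = 2 := by norm_num
      rw [h2]
      gcongr
      linarith [abs_nonneg (φ₂ a)]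
    have : |y| ^ 2 ≤ |y| ^ q := by
      rw [← Real.rpow_natCast]
      exact Real.rpow_le_rpow_of_exponent_le hy (by norm_num; linarith)
    have h4 := mul_le_mul_of_nonneg_left this hK
    have h6 := abs_sub (φ (a + y) - φ a - φ₁ a * y) (φ₂ a / 2 * y ^ 2)
    have e0' : |φ (a + y) - φ a - φ₁ a * y| ≤ K * |y| ^ 2 := e0
    linarith

theorem exists_abs_le_of_hasCompactSupport {φ : ℝ → ℝ} (hc : Continuous φ)
    (hs : HasCompactSupport φ) : ∃ K, ∀ x, |φ x| ≤ K :=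
  hc.bounded_above_of_compact_support hs

/-- A smooth cutoff from `1` to `0`, together with its Taylor expansion of order two. -/
theorem exists_smooth_cutoff : ∃ (g g₁ g₂ : ℝ → ℝ) (K : ℝ), 0 < K ∧ Continuous g ∧
    (∀ x ≤ 0, g x = 1) ∧ (∀ x, 1 ≤ x → g x = 0) ∧ (∀ x, 0 ≤ g x) ∧ (∀ x, g x ≤ 1) ∧
    (∀ x y, |g x - g y| ≤ K * |x - y|) ∧
    ∀ q : ℝ, 2 ≤ q → q ≤ 3 → ∀ a y : ℝ,
      |g (a + y) - g a - g₁ a * y - g₂ a * y ^ 2| ≤ K * |y| ^ q := by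
  set φ : ℝ → ℝ := fun x => Real.smoothTransition (1 - x) with hφ
  have hcd : ContDiff ℝ 4 φ := by
    have : ContDiff ℝ 4 Real.smoothTransition := Real.smoothTransition.contDiff (n := 4)
    exact this.comp (contDiff_const.sub contDiff_id)
  have h1 : ∀ x ≤ 0, φ x = 1 := fun x hx => Real.smoothTransition.one_of_one_le (by linarith)
  have h0 : ∀ x, 1 ≤ x → φ x = 0 := fun x hx =>
    Real.smoothTransition.zero_of_nonpos (by linarith)
  have c1 : ContDiff ℝ 3 (deriv φ) := by
    have := (contDiff_succ_iff_deriv (n := 3) (f := φ)).1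
      (by rw [show (3 + 1 : WithTop ℕ∞) = 4 by norm_num]; exact hcd)
    exact this.2.2
  have c2 : ContDiff ℝ 2 (deriv (deriv φ)) := by
    have := (contDiff_succ_iff_deriv (n := 2) (f := deriv φ)).1
      (by rw [show (2 + 1 : WithTop ℕ∞) = 3 by norm_num]; exact c1)
    exact this.2.2
  have c3 : ContDiff ℝ 1 (deriv (deriv (deriv φ))) := by
    have := (contDiff_succ_iff_deriv (n := 1) (f := deriv (deriv φ))).1
      (by rw [show (1 + 1 : WithTop ℕ∞) = 2 by norm_num]; exact c2)
    exact this.2.2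
  -- The cutoff is not compactly supported, but it is constant off `[0, 1]`, so all its derivatives
  -- are compactly supported and hence bounded.
  have s1 : HasCompactSupport (deriv φ) := by
    refine HasCompactSupport.intro (K := Set.Icc 0 1) isCompact_Icc fun x hx => ?_
    rw [Set.mem_Icc, not_and_or, not_le, not_le] at hx
    rcases hx with hx | hx
    · have : φ =ᶠ[𝓝 x] fun _ => 1 := by
        filter_upwards [Iio_mem_nhds hx] with z hz using h1 z (le_of_lt hz)
      rw [this.deriv_eq]; simp
    · have : φ =ᶠ[𝓝 x] fun _ => 0 := by
        filter_upwards [Ioi_mem_nhds hx] with z hz using h0 z (le_of_lt hz)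
      rw [this.deriv_eq]; simp
  obtain ⟨K1, hK1⟩ := exists_abs_le_of_hasCompactSupport c1.continuous s1
  obtain ⟨K2, hK2⟩ := exists_abs_le_of_hasCompactSupport c2.continuous s1.deriv
  obtain ⟨K3, hK3⟩ := exists_abs_le_of_hasCompactSupport c3.continuous s1.deriv.deriv
  have d1 : ∀ x, HasDerivAt φ (deriv φ x) x := fun x =>
    (hcd.differentiable (by norm_num) x).hasDerivAt
  have d2 : ∀ x, HasDerivAt (deriv φ) (deriv (deriv φ) x) x := fun x =>
    (c1.differentiable (by norm_num) x).hasDerivAt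
  have d3 : ∀ x, HasDerivAt (deriv (deriv φ)) (deriv (deriv (deriv φ)) x) x := fun x =>
    (c2.differentiable (by norm_num) x).hasDerivAt
  have p1 := (abs_nonneg _).trans (hK1 0)
  have p2 := (abs_nonneg _).trans (hK2 0)
  have p3 := (abs_nonneg _).trans (hK3 0)
  -- One constant serves as Lipschitz and as Taylor constant; the `+ 1` makes it positive.
  refine ⟨φ, deriv φ, fun x => deriv (deriv φ) x / 2, K1 + 2 * (K2 + K3) + 1, by linarith,
    hcd.continuous, h1, h0, fun x => Real.smoothTransition.nonneg _,
    fun x => Real.smoothTransition.le_one _, fun x y => ?_, fun q hq hq' a y => ?_⟩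
  · have := convex_univ.norm_image_sub_le_of_norm_hasDerivWithin_le (f := φ) (f' := deriv φ)
      (C := K1) (fun x _ => (d1 x).hasDerivWithinAt) (fun x _ => hK1 x)
      (Set.mem_univ y) (Set.mem_univ x)
    refine this.trans ?_
    rw [Real.norm_eq_abs]
    gcongr
    linarith
  · refine (abs_taylor_two_le d1 d2 d3 (K := K2 + K3) (fun x => (hK2 x).trans (by linarith))
      (fun x => (hK3 x).trans (by linarith)) hq hq' a y).trans ?_
    gcongr
    linarith

/-- For `|t| ≤ 1`, Bernoulli's `(1 + t)^δ ≤ 1 + δ t` reduces the claim to a cubic polynomial. For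
`|t| ≥ 1` the constant is `11 = 8 + 3`: `8 = 2³` bounds the left side, and `3` pays for a negative
linear term. -/
theorem abs_one_add_rpow_le {δ : ℝ} (h0 : 0 ≤ δ) (h1 : δ ≤ 1) (t : ℝ) :
    |1 + t| ^ (2 + δ) ≤ 1 + (2 + δ) * t + 11 * (t ^ 2 + |t| ^ (2 + δ)) := by
  have hp : 0 ≤ |t| ^ (2 + δ) := by positivity
  rcases le_total |t| 1 with ht | ht
  · have ht' := abs_le.1 ht
    have hn : 0 ≤ 1 + t := by linarith
    have e : |1 + t| ^ (2 + δ) ≤ (1 + t) ^ 2 * (1 + δ * t) := by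
      rw [abs_of_nonneg hn, Real.rpow_add_of_nonneg hn (by norm_num) h0]
      have := rpow_one_add_le_one_add_mul_self ht'.1 h0 h1
      rw [Real.rpow_two]
      gcongr
    have h3 : δ * t ^ 3 ≤ t ^ 2 := by
      have : δ * t ≤ 1 := by
        have := abs_le.1 (show |δ * t| ≤ 1 by
          rw [abs_mul, abs_of_nonneg h0]; exact mul_le_one₀ h1 (abs_nonneg _) ht)
        exact this.2
      nlinarith [sq_nonneg t]
    nlinarith [sq_nonneg t]
  · have e1 : |1 + t| ^ (2 + δ) ≤ 8 * |t| ^ (2 + δ) := by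
      have : |1 + t| ≤ 2 * |t| := (abs_add_le _ _).trans (by norm_num; linarith)
      calc |1 + t| ^ (2 + δ) ≤ (2 * |t|) ^ (2 + δ) := by gcongr
        _ = 2 ^ (2 + δ) * |t| ^ (2 + δ) := Real.mul_rpow (by norm_num) (abs_nonneg _)
        _ ≤ 2 ^ (3 : ℝ) * |t| ^ (2 + δ) := by
          gcongr
          · norm_num
          · linarith
        _ = 8 * |t| ^ (2 + δ) := by norm_num
    have e2 : |t| ≤ |t| ^ (2 + δ) := by
      conv_lhs => rw [← Real.rpow_one |t|]
      exact Real.rpow_le_rpow_of_exponent_le ht (by linarith)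
    have e3 : -(3 * |t|) ≤ (2 + δ) * t := by
      have := neg_abs_le ((2 + δ) * t)
      rw [abs_mul, abs_of_nonneg (by linarith : 0 ≤ 2 + δ)] at this
      nlinarith [abs_nonneg t]
    nlinarith [sq_nonneg t]

/-- Rescaling with `t = y / s`. The leading term has coefficient exactly `1` and the linear one a
coefficient depending on `s` alone, so after integration over an independent centred `y` the moments
grow additively. At `s = 0` the linear coefficient is `0` by the convention for division. -/
theorem abs_add_rpow_le {δ : ℝ} (h0 : 0 ≤ δ) (h1 : δ ≤ 1) (s y : ℝ) :
    |s + y| ^ (2 + δ) ≤ |s| ^ (2 + δ) + (2 + δ) * (|s| ^ (2 + δ) / s) * y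
      + 11 * (|s| ^ δ * y ^ 2 + |y| ^ (2 + δ)) := by
  rcases eq_or_ne s 0 with rfl | hs
  · have : 0 ≤ |y| ^ (2 + δ) := by positivity
    have : 0 ≤ |(0 : ℝ)| ^ δ * y ^ 2 := by positivity
    have h : |(0 : ℝ)| ^ (2 + δ) = 0 := by rw [abs_zero, Real.zero_rpow (by linarith)]
    rw [h]; simp only [zero_add, zero_div, mul_zero, zero_mul]
    linarith
  · have key := mul_le_mul_of_nonneg_left (abs_one_add_rpow_le h0 h1 (y / s))
      (by positivity : 0 ≤ |s| ^ (2 + δ))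
    have hs' : 0 < |s| := abs_pos.2 hs
    have e1 : |s| ^ (2 + δ) * |1 + y / s| ^ (2 + δ) = |s + y| ^ (2 + δ) := by
      rw [← Real.mul_rpow (abs_nonneg _) (abs_nonneg _), ← abs_mul]
      congr 2; field_simp
    have e2 : |s| ^ (2 + δ) * |y / s| ^ (2 + δ) = |y| ^ (2 + δ) := by
      rw [← Real.mul_rpow (abs_nonneg _) (abs_nonneg _), ← abs_mul]
      congr 2; field_simp
    have e3 : |s| ^ (2 + δ) * (y / s) ^ 2 = |s| ^ δ * y ^ 2 := by
      rw [Real.rpow_add hs', Real.rpow_two, sq_abs]; field_simp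
    rw [e1] at key
    refine key.trans (le_of_eq ?_)
    calc _ = |s| ^ (2 + δ) + (2 + δ) * (|s| ^ (2 + δ) / s) * y
        + 11 * (|s| ^ (2 + δ) * (y / s) ^ 2 + |s| ^ (2 + δ) * |y / s| ^ (2 + δ)) := by ring
      _ = _ := by rw [e2, e3]

/-! ### Concentration of weighted sums of chi-squared variables -/

/-- The square of the complex Gaussian integral with parameter `b = 1/2 - iu` is `π / b`. The fourth
power of the norm avoids both the branch of the square root and the root in `‖b‖`. -/
theorem norm_integral_cexp_sq_gaussianReal (u : ℝ) :
    ‖∫ x, Complex.exp (Complex.I * u * (x : ℂ) ^ 2) ∂(gaussianReal 0 1)‖ ^ 4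
      = (1 + 4 * u ^ 2)⁻¹ := by
  set b : ℂ := 1 / 2 - Complex.I * u with hb
  have hre : 0 < b.re := by simp [hb]
  have e : ∫ x, Complex.exp (Complex.I * u * (x : ℂ) ^ 2) ∂(gaussianReal 0 1)
      = ((√(2 * Real.pi))⁻¹ : ℝ) * ∫ x : ℝ, Complex.exp (-b * (x : ℂ) ^ 2) := by
    rw [integral_gaussianReal_eq_integral_smul (by simp), ← integral_const_mul]
    refine integral_congr_ae (ae_of_all _ fun x => ?_)
    simp only [gaussianPDFReal, Complex.real_smul]
    push_cast
    rw [mul_assoc, ← Complex.exp_add]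
    simp only [hb, mul_one, sub_zero]
    congr 2
    ring
  have h2 := congrArg norm (integral_gaussian_sq_complex hre)
  rw [norm_pow, norm_div] at h2
  have h3 : ‖b‖ ^ 2 = (1 + 4 * u ^ 2) / 4 := by
    rw [← Complex.normSq_eq_norm_sq, Complex.normSq_apply]
    simp [hb]; ring
  have hbn : 0 < ‖b‖ := lt_of_lt_of_le hre (Complex.re_le_norm b)
  have hpi : ‖(Real.pi : ℂ)‖ = Real.pi := by
    simp [abs_of_pos Real.pi_pos]
  rw [hpi] at h2
  rw [e, norm_mul, mul_pow, Complex.norm_real, Real.norm_eq_abs,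
    abs_of_nonneg (by positivity)]
  have h4 : ((√(2 * Real.pi))⁻¹) ^ 4 = ((2 * Real.pi) ^ 2)⁻¹ := by
    rw [inv_pow, show (4 : ℕ) = 2 * 2 from rfl, pow_mul, Real.sq_sqrt (by positivity)]
  rw [h4, show (4 : ℕ) = 2 * 2 from rfl, pow_mul, h2, div_pow, h3]
  have := Real.pi_pos
  have : (0 : ℝ) < 1 + 4 * u ^ 2 := by positivity
  field_simp
  norm_num

theorem one_add_sum_le_prod_one_add {ι : Type*} (s : Finset ι) (x : ι → ℝ) (hx : ∀ i, 0 ≤ x i) :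
    1 + ∑ i ∈ s, x i ≤ ∏ i ∈ s, (1 + x i) := by
  classical
  induction s using Finset.induction_on with
  | empty => simp
  | insert a s ha ih =>
    rw [Finset.sum_insert ha, Finset.prod_insert ha]
    nlinarith [hx a, Finset.sum_nonneg fun i (_ : i ∈ s) => hx i]

/-- The standard Gaussian measure on `ℝ^ι`. -/
noncomputable abbrev stdGauss (ι : Type*) [Fintype ι] : Measure (ι → ℝ) :=
  Measure.pi fun _ => gaussianReal 0 1

/-- A centred weighted sum of squares. -/
noncomputable def chiSum {ι : Type*} [Fintype ι] (a : ι → ℝ) (ξ : ι → ℝ) : ℝ :=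
  ∑ j, a j * (ξ j ^ 2 - 1)

theorem continuous_chiSum {ι : Type*} [Fintype ι] (a : ι → ℝ) : Continuous (chiSum a) := by
  unfold chiSum; fun_prop

/-- The modulus removes the centring and the shift `t`, and independence gives a product over
coordinates. The estimate is free of the dimension since `∏ (1 + 4u²aⱼ²) ≥ 1 + 4u² ∑ aⱼ² ≥ u²`. -/
theorem norm_integral_cexp_chiSum_le {ι : Type*} [Fintype ι] (a : ι → ℝ)
    (ha : ∑ j, a j ^ 2 = 1) {u : ℝ} (hu : u ≠ 0) (t : ℝ) :
    ‖∫ ξ, Complex.exp (Complex.I * (u * (chiSum a ξ - t) : ℝ)) ∂(stdGauss ι)‖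
      ≤ |u| ^ (-(1 / 2) : ℝ) := by
  have e : ∀ ξ : ι → ℝ, Complex.exp (Complex.I * (u * (chiSum a ξ - t) : ℝ))
      = Complex.exp (((-u * (∑ j, a j + t) : ℝ) : ℂ) * Complex.I) *
        ∏ j, Complex.exp (Complex.I * (u * a j : ℝ) * ((ξ j : ℝ) : ℂ) ^ 2) := fun ξ => by
    rw [← Complex.exp_sum, ← Complex.exp_add, chiSum]
    congr 1
    simp only [mul_sub, Finset.sum_sub_distrib]
    push_cast
    simp only [Finset.mul_sum, mul_add, add_mul, mul_sub, Finset.sum_mul, neg_mul]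
    rw [← sub_eq_zero]
    simp only [mul_one, Finset.sum_neg_distrib]
    have : ∀ j, Complex.I * ((u : ℂ) * ((a j : ℂ) * (ξ j : ℂ) ^ 2))
      = Complex.I * ((u : ℂ) * (a j : ℂ)) * (ξ j : ℂ) ^ 2 := fun j => by ring
    simp only [this, mul_comm]
    ring
  simp_rw [e]
  rw [integral_const_mul, norm_mul, Complex.norm_exp_ofReal_mul_I, one_mul,
    integral_fintype_prod_eq_prod (𝕜 := ℂ)
      (f := fun j (x : ℝ) => Complex.exp (Complex.I * (u * a j : ℝ) * (x : ℂ) ^ 2)), norm_prod]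
  refine le_of_pow_le_pow_left₀ (n := 4) (by norm_num) (by positivity) ?_
  rw [← Finset.prod_pow]
  simp_rw [norm_integral_cexp_sq_gaussianReal]
  rw [Finset.prod_inv_distrib, ← Real.rpow_natCast (|u| ^ _), ← Real.rpow_mul (abs_nonneg u),
    show (-(1 / 2) : ℝ) * (4 : ℕ) = -(2 : ℕ) by norm_num, Real.rpow_neg (abs_nonneg u),
    Real.rpow_natCast, sq_abs]
  have := one_add_sum_le_prod_one_add Finset.univ (fun j => 4 * (u * a j) ^ 2)
    (fun j => by positivity)
  have h2 : ∑ j, 4 * (u * a j) ^ 2 = 4 * u ^ 2 := by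
    simp_rw [mul_pow, ← mul_assoc]; rw [← Finset.mul_sum, ha, mul_one]
  rw [h2] at this
  have : 0 < u ^ 2 := by positivity
  gcongr
  linarith

theorem integrable_abs_rpow_neg_half_gaussianReal :
    Integrable (fun z : ℝ => |z| ^ (-(1 / 2) : ℝ)) (gaussianReal 0 1) := by
  rw [gaussianReal_of_var_ne_zero _ (by simp), integrable_withDensity_iff
    (measurable_gaussianPDF _ _) (ae_of_all _ fun _ => gaussianPDF_lt_top)]
  simp only [toReal_gaussianPDF]
  have h := integrableOn_rpow_mul_exp_neg_mul_sq (b := 1 / 2) (by norm_num)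
    (s := -(1 / 2)) (by norm_num)
  have h' : Integrable fun z : ℝ => |z| ^ (-(1 / 2) : ℝ) * Real.exp (-(1 / 2) * z ^ 2) := by
    rw [← integrableOn_univ, ← Set.Iic_union_Ioi (a := (0 : ℝ)), integrableOn_union]
    constructor
    · rw [integrableOn_Iic_iff_integrableOn_Iio,
        ← (Measure.measurePreserving_neg (volume : Measure ℝ)).integrableOn_comp_preimage
          (Homeomorph.neg ℝ).measurableEmbedding]
      simp only [Function.comp_def, neg_sq, Set.neg_preimage, Set.neg_Iio, neg_zero, abs_neg]
      refine h.congr_fun (fun z hz => ?_) measurableSet_Ioi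
      simp [abs_of_pos (Set.mem_Ioi.1 hz)]
    · refine h.congr_fun (fun z hz => ?_) measurableSet_Ioi
      simp [abs_of_pos (Set.mem_Ioi.1 hz)]
  refine (h'.mul_const (√(2 * Real.pi))⁻¹).congr (ae_of_all _ fun z => ?_)
  simp only [gaussianPDFReal, NNReal.coe_one, mul_one, sub_zero]
  rw [show -z ^ 2 / 2 = -(1 / 2) * z ^ 2 by ring]
  ring

/-- The indicator of the window is at most `e^{1/2}` times `exp (-((V - t)/h)²/2)`, which is the
characteristic function of a standard normal `Z` at `(V - t)/h`. By Fubini, the decay `|u|^{-1/2}`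
at `u = Z/h` gives `h^{1/2} E |Z|^{-1/2}`, which is finite. -/
theorem exists_chiSum_concentration : ∃ C : ℝ, 0 < C ∧ ∀ (ι : Type) [Fintype ι] (a : ι → ℝ),
    ∑ j, a j ^ 2 = 1 → ∀ t h : ℝ, 0 < h →
      (stdGauss ι).real {ξ | |chiSum a ξ - t| ≤ h} ≤ C * h ^ (1 / 2 : ℝ) := by
  set J := ∫ z, |z| ^ (-(1 / 2) : ℝ) ∂(gaussianReal 0 1) with hJ
  have hJ0 : 0 ≤ J := integral_nonneg fun z => by positivity
  refine ⟨Real.exp (1 / 2) * (J + 1), by positivity, fun ι _ a ha t h hh => ?_⟩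
  have mV := (continuous_chiSum a).measurable
  set G : (ι → ℝ) → ℝ := fun ξ => Real.exp (-(((chiSum a ξ - t) / h) ^ 2) / 2) with hG
  have hGc : Continuous G := by
    have := continuous_chiSum a
    fun_prop
  have hG1 : ∀ ξ, ‖G ξ‖ ≤ 1 := fun ξ => by
    rw [Real.norm_eq_abs, abs_of_nonneg (Real.exp_nonneg _)]
    refine Real.exp_le_one_iff.2 ?_
    have := sq_nonneg ((chiSum a ξ - t) / h)
    linarith
  have hGi : Integrable G (stdGauss ι) :=
    Integrable.of_bound hGc.aestronglyMeasurable 1 (ae_of_all _ hG1)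
  have hms : MeasurableSet {ξ | |chiSum a ξ - t| ≤ h} :=
    measurableSet_le (by fun_prop) measurable_const
  have s1 : (stdGauss ι).real {ξ | |chiSum a ξ - t| ≤ h}
      ≤ Real.exp (1 / 2) * ∫ ξ, G ξ ∂(stdGauss ι) := by
    rw [← integral_indicator_one hms, ← integral_const_mul]
    refine integral_mono ((integrable_const (1 : ℝ)).indicator hms) (hGi.const_mul _) fun ξ => ?_
    by_cases hx : ξ ∈ {ξ | |chiSum a ξ - t| ≤ h}
    · rw [Set.indicator_of_mem hx]
      simp only [hG, Pi.one_apply]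
      rw [← Real.exp_add]
      refine Real.one_le_exp ?_
      have : ((chiSum a ξ - t) / h) ^ 2 ≤ 1 := by
        rw [sq_le_one_iff_abs_le_one, abs_div, abs_of_pos hh]
        exact (div_le_one hh).2 hx
      linarith
    · rw [Set.indicator_of_notMem hx]; positivity
  have s2 : ∀ ξ, ((G ξ : ℝ) : ℂ) = ∫ z, Complex.exp (Complex.I * (z / h * (chiSum a ξ - t) : ℝ))
      ∂(gaussianReal 0 1) := fun ξ => by
    have := charFun_gaussianReal (μ := 0) (v := 1) ((chiSum a ξ - t) / h)
    rw [charFun_apply_real] at this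
    rw [hG]
    push_cast
    rw [show (-(((chiSum a ξ : ℂ) - t) / h) ^ 2 / 2) = (((chiSum a ξ - t) / h : ℝ) : ℂ) * (0 : ℝ)
      * Complex.I - ((1 : NNReal) : ℝ) * (((chiSum a ξ - t) / h : ℝ) : ℂ) ^ 2 / 2 by
        push_cast; ring]
    rw [← this]
    refine integral_congr_ae (ae_of_all _ fun z => ?_)
    simp only
    congr 1
    push_cast
    ring
  have s3 : ((∫ ξ, G ξ ∂(stdGauss ι) : ℝ) : ℂ) = ∫ z, ∫ ξ,
      Complex.exp (Complex.I * (z / h * (chiSum a ξ - t) : ℝ)) ∂(stdGauss ι)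
        ∂(gaussianReal 0 1) := by
    rw [← integral_complex_ofReal]
    simp_rw [s2]
    refine integral_integral_swap ?_
    refine Integrable.of_bound (C := 1) ?_ (ae_of_all _ fun z => ?_)
    · refine Continuous.aestronglyMeasurable ?_
      have := continuous_chiSum a
      simp only [Function.uncurry_def]
      fun_prop
    · simp only [Function.uncurry_def]
      rw [mul_comm, Complex.norm_exp_ofReal_mul_I]
  have hint : Integrable (fun z : ℝ => h ^ (1 / 2 : ℝ) * |z| ^ (-(1 / 2) : ℝ))
    (gaussianReal 0 1) := integrable_abs_rpow_neg_half_gaussianReal.const_mul _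
  have s4 : ∫ ξ, G ξ ∂(stdGauss ι) ≤ h ^ (1 / 2 : ℝ) * J := by
    calc ∫ ξ, G ξ ∂(stdGauss ι) ≤ ‖((∫ ξ, G ξ ∂(stdGauss ι) : ℝ) : ℂ)‖ := by
          rw [Complex.norm_real]; exact Real.le_norm_self _
      _ ≤ ∫ z, h ^ (1 / 2 : ℝ) * |z| ^ (-(1 / 2) : ℝ) ∂(gaussianReal 0 1) := by
          rw [s3]
          refine norm_integral_le_of_norm_le hint ?_
          -- The point `z = 0` has to be discarded: there the inner integral is `1`, while `|0| ^
          -- (-1/2)` is `0` by convention.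
          have hna : NullSingletonClass (gaussianReal 0 1) :=
            nullSingletonClass_gaussianReal (by simp)
          filter_upwards [(Set.finite_singleton (0 : ℝ)).countable.ae_notMem
            (gaussianReal 0 1)] with z hz
          have hz' : z ≠ 0 := by simpa using hz
          refine (norm_integral_cexp_chiSum_le a ha (u := z / h)
            (div_ne_zero hz' hh.ne') t).trans (le_of_eq ?_)
          rw [abs_div, abs_of_pos hh, Real.div_rpow (abs_nonneg _) hh.le,
            Real.rpow_neg hh.le]
          field_simp
      _ = h ^ (1 / 2 : ℝ) * J := integral_const_mul _ _
  calc _ ≤ Real.exp (1 / 2) * (h ^ (1 / 2 : ℝ) * J) := by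
        refine s1.trans ?_
        gcongr
    _ ≤ _ := by
        have : 0 ≤ Real.exp (1 / 2) * h ^ (1 / 2 : ℝ) := by positivity
        nlinarith

/-! ### Moments of convolutions on the real line -/

theorem rpow_le_one_add_rpow {x r q : ℝ} (hx : 0 ≤ x) (hr : 0 ≤ r) (hrq : r ≤ q) :
    x ^ r ≤ 1 + x ^ q := by
  have h1 : 0 ≤ x ^ q := by positivity
  rcases le_total x 1 with h | h
  · linarith [Real.rpow_le_one hx h hr]
  · linarith [Real.rpow_le_rpow_of_exponent_le h hrq]

theorem norm_add_rpow_le {F : Type*} [SeminormedAddCommGroup F] {q : ℝ} (h0 : 0 ≤ q)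
    (h3 : q ≤ 3) (x y : F) : ‖x + y‖ ^ q ≤ 8 * (‖x‖ ^ q + ‖y‖ ^ q) := by
  have key : ∀ a b : ℝ, 0 ≤ a → a ≤ b → ∀ z : F, ‖z‖ ≤ a + b → ‖z‖ ^ q ≤ 8 * (a ^ q + b ^ q) := by
    intro a b ha hab z hz
    have hb := ha.trans hab
    calc ‖z‖ ^ q ≤ (2 * b) ^ q := by gcongr; linarith
      _ = 2 ^ q * b ^ q := Real.mul_rpow (by norm_num) hb
      _ ≤ 2 ^ (3 : ℝ) * b ^ q := by gcongr; norm_num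
      _ = 8 * b ^ q := by norm_num
      _ ≤ _ := by have : 0 ≤ a ^ q := by positivity
                  linarith
  rcases le_total ‖x‖ ‖y‖ with h | h
  · exact key _ _ (norm_nonneg _) h _ (norm_add_le x y)
  · rw [add_comm (‖x‖ ^ q)]
    exact key _ _ (norm_nonneg _) h _ ((norm_add_le x y).trans_eq (add_comm _ _))

/-- A centred probability measure on `ℝ` with variance `v` and a finite absolute moment of order
`2 + δ`. -/
structure IsCentred (δ : ℝ) (μ : Measure ℝ) (v : ℝ) : Prop where
  prob : IsProbabilityMeasure μ
  int : Integrable (fun x => |x| ^ (2 + δ)) μ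
  mean : ∫ x, x ∂μ = 0
  var : ∫ x, x ^ 2 ∂μ = v

namespace IsCentred

variable {δ v w : ℝ} {μ ν : Measure ℝ}

theorem integrable_rpow (h : IsCentred δ μ v) {r : ℝ} (hr : 0 ≤ r) (hr' : r ≤ 2 + δ) :
    Integrable (fun x => |x| ^ r) μ := by
  have := h.prob
  refine ((integrable_const (1 : ℝ)).add h.int).mono' (by fun_prop) (ae_of_all _ fun x => ?_)
  rw [Real.norm_eq_abs, abs_of_nonneg (by positivity)]
  exact rpow_le_one_add_rpow (abs_nonneg _) hr hr'

theorem integrable_sq (h : IsCentred δ μ v) (h0 : 0 ≤ δ) : Integrable (fun x => x ^ 2) μ := by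
  refine (h.integrable_rpow (r := 2) (by norm_num) (by linarith)).congr (ae_of_all _ fun x => ?_)
  simp

theorem integrable_id (h : IsCentred δ μ v) (h0 : 0 ≤ δ) : Integrable (fun x => x) μ := by
  have := h.integrable_rpow (r := 1) (by norm_num) (by linarith)
  exact this.mono' (by fun_prop) (ae_of_all _ fun x => by simp)

theorem var_nonneg (h : IsCentred δ μ v) : 0 ≤ v := by
  rw [← h.var]; exact integral_nonneg fun x => sq_nonneg x

theorem integral_rpow_le (h : IsCentred δ μ v) (h0 : 0 ≤ δ) (h1 : δ ≤ 1) :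
    ∫ x, |x| ^ δ ∂μ ≤ v ^ (δ / 2) := by
  have := h.prob
  have e : ∀ x : ℝ, (x ^ 2) ^ (δ / 2) = |x| ^ δ := fun x => by
    rw [← sq_abs, ← Real.rpow_natCast, ← Real.rpow_mul (abs_nonneg _)]
    congr 1; push_cast; ring
  have key := ConcaveOn.le_map_integral (μ := μ) (f := fun x : ℝ => x ^ 2)
    (Real.concaveOn_rpow (p := δ / 2) (by linarith) (by linarith))
    (Real.continuous_rpow_const (by linarith)).continuousOn isClosed_Ici
    (ae_of_all _ fun x => sq_nonneg x) (h.integrable_sq h0)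
    (by simpa only [Function.comp_def, e] using h.integrable_rpow h0 (by linarith))
  simpa only [e, h.var] using key

theorem dirac_zero : IsCentred δ (Measure.dirac 0) 0 where
  prob := inferInstance
  int := integrable_dirac (by simp)
  mean := by simp
  var := by simp

theorem conv (h : IsCentred δ μ v) (h' : IsCentred δ ν w) (h0 : 0 ≤ δ) (h1 : δ ≤ 1) :
    IsCentred δ (μ ∗ ν) (v + w) := by
  have := h.prob
  have := h'.prob
  have hi : Integrable (fun x => |x| ^ (2 + δ)) (μ ∗ ν) := by
    rw [Measure.conv, integrable_map_measure (by fun_prop (disch := linarith)) (by fun_prop)]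
    refine (((h.int.comp_fst ν).add (h'.int.comp_snd μ)).const_mul 8).mono'
      (by fun_prop (disch := linarith))
      (ae_of_all _ fun x => ?_)
    rw [Function.comp_apply, Real.norm_eq_abs, abs_of_nonneg (by positivity)]
    exact norm_add_rpow_le (by linarith) (by linarith) x.1 x.2
  refine ⟨inferInstance, hi, ?_, ?_⟩
  · rw [Measure.conv, integral_map (by fun_prop) (by fun_prop),
      integral_add ((h.integrable_id h0).comp_fst ν) ((h'.integrable_id h0).comp_snd μ),
      integral_fun_fst (fun x => x), integral_fun_snd (fun x => x), h.mean, h'.mean]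
    simp
  · rw [Measure.conv, integral_map (by fun_prop) (by fun_prop)]
    have hm := (h.integrable_id h0).mul_prod (h'.integrable_id h0)
    have e : ∀ x : ℝ × ℝ, (x.1 + x.2) ^ 2 = x.1 ^ 2 + 2 * (x.1 * x.2) + x.2 ^ 2 :=
      fun x => by ring
    simp_rw [e]
    have i1 := (h.integrable_sq h0).comp_fst ν
    have i2 := (h'.integrable_sq h0).comp_snd μ
    have i12 : Integrable (fun x : ℝ × ℝ => x.1 ^ 2 + 2 * (x.1 * x.2)) (μ.prod ν) :=
      i1.add (hm.const_mul 2)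
    rw [integral_add i12 i2, integral_add i1 (hm.const_mul 2),
      integral_const_mul, integral_prod_mul (fun x : ℝ => x) (fun x => x),
      integral_fun_fst (fun x : ℝ => x ^ 2), integral_fun_snd (fun x : ℝ => x ^ 2),
      h.mean, h.var, h'.var]
    simp

/-- One step of the Rosenthal recursion: in `abs_add_rpow_le` the linear term integrates to zero,
and Jensen bounds the remaining `E |s|^δ` by `v^{δ/2}`. -/
theorem integral_conv_le (h : IsCentred δ μ v) (h' : IsCentred δ ν w) (h0 : 0 ≤ δ)
    (h1 : δ ≤ 1) : ∫ x, |x| ^ (2 + δ) ∂(μ ∗ ν) ≤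
      ∫ x, |x| ^ (2 + δ) ∂μ + 11 * (v ^ (δ / 2) * w + ∫ x, |x| ^ (2 + δ) ∂ν) := by
  have := h.prob
  have := h'.prob
  have hc := h.conv h' h0 h1
  rw [integral_conv hc.int]
  set m := ∫ x, |x| ^ (2 + δ) ∂ν
  have inner : ∀ s : ℝ, ∫ y, |s + y| ^ (2 + δ) ∂ν ≤ |s| ^ (2 + δ) + 11 * (|s| ^ δ * w + m) := by
    intro s
    by_cases hs : Integrable (fun y => |s + y| ^ (2 + δ)) ν
    · have j1 : Integrable (fun y : ℝ => (2 + δ) * (|s| ^ (2 + δ) / s) * y) ν :=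
        (h'.integrable_id h0).const_mul _
      have j2 : Integrable (fun y : ℝ => |s| ^ δ * y ^ 2) ν := (h'.integrable_sq h0).const_mul _
      have j3 : Integrable (fun _ : ℝ => |s| ^ (2 + δ)) ν := integrable_const _
      have j4 : Integrable (fun y : ℝ => 11 * (|s| ^ δ * y ^ 2 + |y| ^ (2 + δ))) ν :=
        (j2.add h'.int).const_mul _
      have j5 : Integrable (fun y : ℝ => |s| ^ (2 + δ) + (2 + δ) * (|s| ^ (2 + δ) / s) * y) ν :=
        j3.add j1
      refine (integral_mono hs (j5.add j4) (abs_add_rpow_le h0 h1 s)).trans (le_of_eq ?_)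
      simp only [Pi.add_apply]
      rw [integral_add j5 j4, integral_add j3 j1, integral_const_mul,
        integral_const_mul, integral_add j2 h'.int, integral_const_mul, h'.mean, h'.var]
      simp [m]
    -- A non-integrable integrand has integral `0` by convention, so the bound is trivial.
    · rw [integral_undef hs]
      have hm : 0 ≤ m := integral_nonneg fun x => by positivity
      have := h'.var_nonneg
      positivity
  have i1 := h.integrable_rpow (r := δ) h0 (by linarith)
  have i2 : Integrable (fun s : ℝ => 11 * (|s| ^ δ * w + m)) μ :=
    ((i1.mul_const w).add (integrable_const m)).const_mul 11
  have hl : Integrable (fun s => ∫ y, |s + y| ^ (2 + δ) ∂ν) μ := by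
    have := hc.int
    rw [Measure.conv, integrable_map_measure (by fun_prop (disch := linarith)) (by fun_prop)] at this
    exact this.integral_prod_left
  refine (integral_mono hl (h.int.add i2) inner).trans ?_
  simp only [Pi.add_apply]
  rw [integral_add h.int i2, integral_const_mul, integral_add (i1.mul_const w)
    (integrable_const m), integral_mul_const]
  have := h.integral_rpow_le h0 h1
  have := h'.var_nonneg
  simp only [integral_const, probReal_univ, smul_eq_mul, one_mul]
  gcongr

end IsCentred

/-- The `n`-fold convolution power of a measure. -/
noncomputable def convPow {G : Type*} [AddMonoid G] [MeasurableSpace G] (ρ : Measure G) :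
    ℕ → Measure G
  | 0 => Measure.dirac 0
  | n + 1 => convPow ρ n ∗ ρ

instance isProbabilityMeasure_convPow {G : Type*} [AddMonoid G] [MeasurableSpace G]
    [MeasurableAdd₂ G] (ρ : Measure G) [IsProbabilityMeasure ρ] (n : ℕ) :
    IsProbabilityMeasure (convPow ρ n) := by
  induction n with
  | zero => exact inferInstanceAs (IsProbabilityMeasure (Measure.dirac 0))
  | succ n ih => exact inferInstanceAs (IsProbabilityMeasure (convPow ρ n ∗ ρ))

theorem convPow_succ {G : Type*} [AddMonoid G] [MeasurableSpace G] (ρ : Measure G) (n : ℕ) :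
    convPow ρ (n + 1) = convPow ρ n ∗ ρ := rfl

theorem convPow_map {F F' : Type*} [NormedAddCommGroup F] [NormedSpace ℝ F] [MeasurableSpace F]
    [BorelSpace F] [SecondCountableTopology F] [NormedAddCommGroup F'] [NormedSpace ℝ F']
    [MeasurableSpace F'] [BorelSpace F'] [SecondCountableTopology F']
    (L : F →L[ℝ] F')
    (ρ : Measure F) [IsProbabilityMeasure ρ] (n : ℕ) :
    (convPow ρ n).map L = convPow (ρ.map L) n := by
  induction n with
  | zero => simp [convPow, Measure.map_dirac' L.measurable]
  | succ n ih => rw [convPow_succ, Measure.map_conv_continuousLinearMap, ih, convPow_succ]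

/-- A Rosenthal bound, accumulated along convolutions: `V` bounds the variance `v`. -/
structure RosenthalBound (δ V : ℝ) (μ : Measure ℝ) (v m : ℝ) : Prop extends IsCentred δ μ v where
  bound : ∫ x, |x| ^ (2 + δ) ∂μ ≤ 11 * (V ^ (δ / 2) * v + m)

theorem RosenthalBound.dirac_zero {δ V : ℝ} (h0 : 0 ≤ δ) :
    RosenthalBound δ V (Measure.dirac 0) 0 0 where
  toIsCentred := IsCentred.dirac_zero
  bound := by simp [Real.zero_rpow (by linarith : 2 + δ ≠ 0)]

/-- Each new summand adds at most `11 (V^{δ/2} w + E|y|^q)`, since the variance reached so far stays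
below the ceiling `V`. The constant is not compounded, and an arbitrary starting measure lets blocks
with different laws be chained. -/
theorem RosenthalBound.conv_convPow {δ V v m w : ℝ} {μ ν : Measure ℝ}
    (h : RosenthalBound δ V μ v m) (h' : IsCentred δ ν w) (h0 : 0 ≤ δ) (h1 : δ ≤ 1) (l : ℕ)
    (hV : v + l * w ≤ V) :
    RosenthalBound δ V (μ ∗ convPow ν l) (v + l * w) (m + l * ∫ x, |x| ^ (2 + δ) ∂ν) := by
  have := h.prob
  have := h'.prob
  have hw := h'.var_nonneg
  induction l with
  | zero => simpa [convPow] using h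
  | succ l ih =>
    have hV' : v + l * w ≤ V := by push_cast at hV; linarith
    specialize ih hV'
    have hc := ih.toIsCentred.conv h' h0 h1
    have hb := ih.toIsCentred.integral_conv_le h' h0 h1
    rw [convPow_succ, ← Measure.conv_assoc]
    refine ⟨by convert hc using 1; push_cast; ring, hb.trans ?_⟩
    have := ih.bound
    have h2 : (v + l * w) ^ (δ / 2) ≤ V ^ (δ / 2) := by
      have := ih.toIsCentred.var_nonneg
      gcongr
    have h3 := mul_le_mul_of_nonneg_right h2 hw
    push_cast
    linarith

theorem rosenthal_convPow {δ w : ℝ} {μ ν : Measure ℝ} (h : IsCentred δ μ w)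
    (h' : IsCentred δ ν w) (h0 : 0 ≤ δ) (h1 : δ ≤ 1) {k l n : ℕ} (hkl : k + l ≤ n) :
    ∫ x, |x| ^ (2 + δ) ∂(convPow μ k ∗ convPow ν l) ≤
      11 * (n ^ (1 + δ / 2) * w ^ (1 + δ / 2) + n * ∫ x, |x| ^ (2 + δ) ∂μ
        + n * ∫ x, |x| ^ (2 + δ) ∂ν) := by
  have := h.prob
  have := h'.prob
  have hw := h.var_nonneg
  have hk : (k : ℝ) ≤ n := by exact_mod_cast (by omega : k ≤ n)
  have hl : (l : ℝ) ≤ n := by exact_mod_cast (by omega : l ≤ n)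
  have hkl' : (k : ℝ) + l ≤ n := by exact_mod_cast hkl
  have e1 := (RosenthalBound.dirac_zero (V := n * w) h0).conv_convPow h h0 h1 k
    (by rw [zero_add]; gcongr)
  have e2 := e1.conv_convPow h' h0 h1 l (by rw [zero_add, ← add_mul]; gcongr)
  have hb := e2.bound
  rw [Measure.dirac_zero_conv] at hb
  refine hb.trans ?_
  have m1 : 0 ≤ ∫ x, |x| ^ (2 + δ) ∂μ := integral_nonneg fun x => by positivity
  have m2 : 0 ≤ ∫ x, |x| ^ (2 + δ) ∂ν := integral_nonneg fun x => by positivity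
  have h4 : (n * w : ℝ) ^ (δ / 2) * (0 + k * w + l * w) ≤ n ^ (1 + δ / 2) * w ^ (1 + δ / 2) := by
    calc (n * w : ℝ) ^ (δ / 2) * (0 + k * w + l * w) ≤ (n * w : ℝ) ^ (δ / 2) * (n * w) := by
          gcongr
          rw [zero_add, ← add_mul]
          gcongr
      _ = (n * w) ^ (1 + δ / 2) := by
          rw [Real.rpow_add_of_nonneg (by positivity) (by norm_num) (by linarith), Real.rpow_one,
            mul_comm]
      _ = _ := Real.mul_rpow (by positivity) hw
  have h5 := mul_le_mul_of_nonneg_right hk m1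
  have h6 := mul_le_mul_of_nonneg_right hl m2
  linarith

/-! ### The Lindeberg replacement argument -/

section Lindeberg

variable {E : Type*} [NormedAddCommGroup E] [InnerProductSpace ℝ E] [FiniteDimensional ℝ E]
  [MeasurableSpace E] [BorelSpace E]

/-- A centred probability measure with covariance form `s` and a finite moment of order `2 + δ`. -/
structure IsCentredVec (δ : ℝ) (ν : Measure E) (s : E → ℝ) : Prop where
  prob : IsProbabilityMeasure ν
  int : Integrable (fun x => ‖x‖ ^ (2 + δ)) ν
  mean : ∀ w, ∫ x, inner ℝ w x ∂ν = 0
  var : ∀ w, ∫ x, inner ℝ w x ^ 2 ∂ν = s w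
  cont : Continuous s

/-- `E |⟨W, X⟩|^{2+δ}` for independent `W ∼ M` and `X ∼ ν`. -/
noncomputable def pairMoment (δ : ℝ) (M ν : Measure E) : ℝ :=
  ∫ x, ∫ w, |inner ℝ w x| ^ (2 + δ) ∂M ∂ν

/-- The law of `(X, |X|²)` for `X ∼ ν`. -/
noncomputable def withNormSq (ν : Measure E) : Measure (E × ℝ) :=
  ν.map fun x => (x, ‖x‖ ^ 2)

instance (ν : Measure E) [IsProbabilityMeasure ν] : IsProbabilityMeasure (withNormSq ν) :=
  Measure.isProbabilityMeasure_map (by fun_prop)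

theorem withNormSq_map_fst (ν : Measure E) :
    (withNormSq ν).map (ContinuousLinearMap.fst ℝ E ℝ) = ν := by
  rw [withNormSq, Measure.map_map (by fun_prop) (by fun_prop)]
  exact Measure.map_id

variable {δ : ℝ} {s : E → ℝ} {μ ν M : Measure E}

theorem integrable_inner_rpow_prod (h0 : 0 ≤ δ) [SFinite M] [SFinite ν]
    (hM : Integrable (fun x => ‖x‖ ^ (2 + δ)) M)
    (hν : Integrable (fun x => ‖x‖ ^ (2 + δ)) ν) :
    Integrable (fun p : E × E => |inner ℝ p.1 p.2| ^ (2 + δ)) (M.prod ν) := by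
  refine (hM.mul_prod hν).mono' (by fun_prop (disch := linarith)) (ae_of_all _ fun p => ?_)
  rw [Real.norm_eq_abs, abs_of_nonneg (by positivity), ← Real.mul_rpow (by positivity)
    (by positivity)]
  gcongr
  exact abs_real_inner_le_norm _ _

theorem integrable_norm_rpow_conv (h0 : 0 ≤ δ) (h1 : δ ≤ 1) [IsProbabilityMeasure M]
    [IsProbabilityMeasure ν] (hM : Integrable (fun x => ‖x‖ ^ (2 + δ)) M)
    (hν : Integrable (fun x => ‖x‖ ^ (2 + δ)) ν) :
    Integrable (fun x => ‖x‖ ^ (2 + δ)) (M ∗ ν) := by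
  rw [Measure.conv, integrable_map_measure (by fun_prop (disch := linarith)) (by fun_prop)]
  refine (((hM.comp_fst ν).add (hν.comp_snd M)).const_mul 8).mono'
    (by fun_prop (disch := linarith)) (ae_of_all _ fun x => ?_)
  rw [Function.comp_apply, Real.norm_eq_abs, abs_of_nonneg (by positivity)]
  exact norm_add_rpow_le (by linarith) (by linarith) x.1 x.2

theorem integrable_norm_rpow_convPow (h0 : 0 ≤ δ) (h1 : δ ≤ 1) [IsProbabilityMeasure ν]
    (hν : Integrable (fun x => ‖x‖ ^ (2 + δ)) ν) (n : ℕ) :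
    Integrable (fun x => ‖x‖ ^ (2 + δ)) (convPow ν n) := by
  induction n with
  | zero => exact integrable_dirac (by simp)
  | succ n ih => exact integrable_norm_rpow_conv h0 h1 ih hν

namespace IsCentredVec

theorem map_inner (h : IsCentredVec δ ν s) (h0 : 0 ≤ δ) (w : E) :
    IsCentred δ (ν.map (innerSL ℝ w)) (s w) := by
  have := h.prob
  have hm : AEMeasurable (innerSL ℝ w) ν := (innerSL ℝ w).continuous.aemeasurable
  refine ⟨Measure.isProbabilityMeasure_map hm, ?_, ?_, ?_⟩
  · rw [integrable_map_measure (by fun_prop (disch := linarith)) hm]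
    refine (h.int.const_mul (‖w‖ ^ (2 + δ))).mono' ?_ (ae_of_all _ fun x => ?_)
    · exact Continuous.aestronglyMeasurable (by
        simp only [Function.comp_def]; fun_prop (disch := linarith))
    · rw [Function.comp_apply, Real.norm_eq_abs, abs_of_nonneg (by positivity),
        ← Real.mul_rpow (by positivity) (by positivity), innerSL_apply_apply]
      gcongr
      exact abs_real_inner_le_norm _ _
  · rw [integral_map hm (by fun_prop)]
    simpa using h.mean w
  · rw [integral_map hm (by fun_prop)]
    simpa using h.var w

theorem integral_map_inner (w : E) (h0 : 0 ≤ δ) :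
    ∫ x, |x| ^ (2 + δ) ∂(ν.map (innerSL ℝ w)) = ∫ x, |inner ℝ w x| ^ (2 + δ) ∂ν := by
  rw [integral_map (innerSL ℝ w).continuous.aemeasurable (by fun_prop (disch := linarith))]
  simp

theorem var_nonneg (h : IsCentredVec δ ν s) (w : E) : 0 ≤ s w := by
  rw [← h.var w]; exact integral_nonneg fun x => sq_nonneg _

theorem integrable_norm_sq (h : IsCentredVec δ ν s) (h0 : 0 ≤ δ) :
    Integrable (fun x => ‖x‖ ^ 2) ν := by
  have := h.prob
  refine ((integrable_const (1 : ℝ)).add h.int).mono' (by fun_prop) (ae_of_all _ fun x => ?_)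
  rw [Real.norm_eq_abs, abs_of_nonneg (by positivity), ← Real.rpow_two]
  exact rpow_le_one_add_rpow (norm_nonneg _) (by norm_num) (by linarith)

theorem var_le (h : IsCentredVec δ ν s) (h0 : 0 ≤ δ) (w : E) :
    s w ≤ (∫ x, ‖x‖ ^ 2 ∂ν) * ‖w‖ ^ 2 := by
  rw [← h.var w, ← integral_mul_const]
  refine integral_mono_of_nonneg (ae_of_all _ fun x => sq_nonneg _)
    ((h.integrable_norm_sq h0).mul_const _) (ae_of_all _ fun x => ?_)
  simp only
  rw [← mul_pow, ← sq_abs, mul_comm]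
  gcongr
  exact abs_real_inner_le_norm _ _

theorem integrable_var_rpow (h : IsCentredVec δ μ s) (hν : IsCentredVec δ ν s) (h0 : 0 ≤ δ) :
    Integrable (fun w => s w ^ (1 + δ / 2)) ν := by
  set S := ∫ x, ‖x‖ ^ 2 ∂μ
  have hS : 0 ≤ S := integral_nonneg fun x => by positivity
  have hc := h.cont
  refine (hν.int.const_mul (S ^ (1 + δ / 2))).mono'
    (hc.rpow_const fun x => Or.inr (by linarith)).aestronglyMeasurable (ae_of_all _ fun w => ?_)
  have hs := h.var_nonneg w
  rw [Real.norm_eq_abs, abs_of_nonneg (by positivity)]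
  have e : ‖w‖ ^ (2 + δ) = (‖w‖ ^ 2) ^ (1 + δ / 2) := by
    rw [← Real.rpow_natCast, ← Real.rpow_mul (norm_nonneg _)]
    congr 1; push_cast; ring
  rw [e, ← Real.mul_rpow hS (by positivity)]
  gcongr
  exact h.var_le h0 w

end IsCentredVec

theorem pairMoment_comm (h0 : 0 ≤ δ) [SFinite M] [SFinite ν]
    (hM : Integrable (fun x => ‖x‖ ^ (2 + δ)) M)
    (hν : Integrable (fun x => ‖x‖ ^ (2 + δ)) ν) : pairMoment δ M ν = pairMoment δ ν M := by
  rw [pairMoment, pairMoment, integral_integral_swap]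
  · simp_rw [real_inner_comm]
  · exact integrable_inner_rpow_prod h0 hν hM |>.congr (ae_of_all _ fun p => by
      simp [Function.uncurry_def, real_inner_comm])

theorem integrable_integral_inner_rpow (h0 : 0 ≤ δ) [SFinite M] [SFinite ν]
    (hM : Integrable (fun x => ‖x‖ ^ (2 + δ)) M)
    (hν : Integrable (fun x => ‖x‖ ^ (2 + δ)) ν) :
    Integrable (fun x => ∫ w, |inner ℝ w x| ^ (2 + δ) ∂M) ν :=
  (integrable_inner_rpow_prod h0 hM hν).integral_prod_right

/-- For a fixed `x ∼ τ`, pairing with `x` turns the vector sum into a sum of centred real variables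
of common variance `s x`. The scalar Rosenthal bound is applied for each `x` and then integrated. -/
theorem pairMoment_convPow_le {τ : Measure E} (hμ : IsCentredVec δ μ s)
    (hν : IsCentredVec δ ν s) (hτ : IsCentredVec δ τ s) (h0 : 0 ≤ δ) (h1 : δ ≤ 1) {k l n : ℕ}
    (hkl : k + l ≤ n) :
    pairMoment δ (convPow μ k ∗ convPow ν l) τ ≤
      11 * (n ^ (1 + δ / 2) * ∫ x, s x ^ (1 + δ / 2) ∂τ + n * pairMoment δ μ τ
        + n * pairMoment δ ν τ) := by
  have := hμ.prob
  have := hν.prob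
  have := hτ.prob
  have i0 := (hμ.integrable_var_rpow hτ h0).const_mul ((n : ℝ) ^ (1 + δ / 2))
  have i1 := (integrable_integral_inner_rpow h0 hμ.int hτ.int).const_mul (n : ℝ)
  have i2 := (integrable_integral_inner_rpow h0 hν.int hτ.int).const_mul (n : ℝ)
  have i01 : Integrable (fun x => (n : ℝ) ^ (1 + δ / 2) * s x ^ (1 + δ / 2)
    + n * ∫ w, |inner ℝ w x| ^ (2 + δ) ∂μ) τ := i0.add i1
  have i3 := integrable_integral_inner_rpow h0 (integrable_norm_rpow_conv h0 h1
    (integrable_norm_rpow_convPow h0 h1 hμ.int k) (integrable_norm_rpow_convPow h0 h1 hν.int l))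
    hτ.int
  unfold pairMoment
  rw [← integral_const_mul, ← integral_const_mul, ← integral_const_mul, ← integral_add i0 i1,
    ← integral_add i01 i2, ← integral_const_mul]
  refine integral_mono i3 ((i01.add i2).const_mul 11) fun x => ?_
  have key := rosenthal_convPow (hμ.map_inner h0 x) (hν.map_inner h0 x) h0 h1 hkl
  rw [← convPow_map, ← convPow_map, ← Measure.map_conv_continuousLinearMap,
    IsCentredVec.integral_map_inner x h0, IsCentredVec.integral_map_inner x h0,
    IsCentredVec.integral_map_inner x h0] at key
  simpa only [real_inner_comm] using key

variable {g g₁ g₂ : ℝ → ℝ} {C : ℝ}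

/-- The main term depends on `ν` only through `s`, so it cancels between two measures with the same
covariance form. -/
theorem abs_integral_taylor_le (hν : IsCentredVec δ ν s) (h0 : 0 ≤ δ) (hg : Continuous g)
    (hg0 : ∀ x, 0 ≤ g x) (hg1 : ∀ x, g x ≤ 1)
    (hT : ∀ a y, |g (a + y) - g a - g₁ a * y - g₂ a * y ^ 2| ≤ C * |y| ^ (2 + δ))
    (a r : ℝ) (hr : 0 ≤ r) (w : E) :
    |∫ x, g (a + r * inner ℝ w x) ∂ν - (g a + g₂ a * r ^ 2 * s w)|
      ≤ C * r ^ (2 + δ) * ∫ x, |inner ℝ w x| ^ (2 + δ) ∂ν := by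
  have := hν.prob
  have hI := hν.map_inner h0 w
  have hm : AEMeasurable (innerSL ℝ w) ν := (innerSL ℝ w).continuous.aemeasurable
  have k1 : Integrable (fun x => inner ℝ w x) ν := by
    have := (integrable_map_measure (by fun_prop) hm).1 (hI.integrable_id h0)
    simpa [Function.comp_def] using this
  have k2 : Integrable (fun x => inner ℝ w x ^ 2) ν := by
    have := (integrable_map_measure (by fun_prop) hm).1 (hI.integrable_sq h0)
    simpa [Function.comp_def] using this
  have k3 : Integrable (fun x => |inner ℝ w x| ^ (2 + δ)) ν := by
    have := (integrable_map_measure (by fun_prop (disch := linarith)) hm).1 hI.int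
    simpa [Function.comp_def] using this
  have kg : Integrable (fun x => g (a + r * inner ℝ w x)) ν :=
    Integrable.of_bound (by fun_prop) 1 (ae_of_all _ fun x => by
      rw [Real.norm_eq_abs, abs_of_nonneg (hg0 _)]; exact hg1 _)
  have j1 : Integrable (fun x => g₁ a * (r * inner ℝ w x)) ν := (k1.const_mul r).const_mul _
  have j2 : Integrable (fun x => g₂ a * (r * inner ℝ w x) ^ 2) ν := by
    simp_rw [mul_pow]; exact (k2.const_mul (r ^ 2)).const_mul _
  have j0 : Integrable (fun x => g (a + r * inner ℝ w x) - g a) ν :=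
    kg.sub (integrable_const _)
  have j01 : Integrable (fun x => g (a + r * inner ℝ w x) - g a - g₁ a * (r * inner ℝ w x)) ν :=
    j0.sub j1
  have e : ∫ x, g (a + r * inner ℝ w x) ∂ν - (g a + g₂ a * r ^ 2 * s w)
      = ∫ x, (g (a + r * inner ℝ w x) - g a - g₁ a * (r * inner ℝ w x)
        - g₂ a * (r * inner ℝ w x) ^ 2) ∂ν := by
    rw [integral_sub j01 j2, integral_sub j0 j1, integral_sub kg (integrable_const _)]
    simp_rw [mul_pow]
    simp only [integral_const_mul, hν.mean, hν.var, integral_const, probReal_univ, smul_eq_mul]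
    ring
  rw [e, ← integral_const_mul]
  refine (Real.norm_eq_abs _).symm.trans_le
    (norm_integral_le_of_norm_le (k3.const_mul _) (ae_of_all _ fun x => ?_))
  refine (hT a (r * inner ℝ w x)).trans (le_of_eq ?_)
  rw [abs_mul, abs_of_nonneg hr, Real.mul_rpow hr (abs_nonneg _), mul_assoc]

/-- The test function applied to the off-diagonal quadratic form `|W|² - r`. -/
noncomputable def quadTest (g : ℝ → ℝ) (c : ℝ) (b : E × ℝ) : ℝ := g ((‖b.1‖ ^ 2 - b.2) / c)

theorem continuous_quadTest (hg : Continuous g) (c : ℝ) :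
    Continuous (quadTest g c : E × ℝ → ℝ) := by
  unfold quadTest; fun_prop

theorem integrable_quadTest (hg : Continuous g) (hg0 : ∀ x, 0 ≤ g x) (hg1 : ∀ x, g x ≤ 1)
    (c : ℝ) (B : Measure (E × ℝ)) [IsFiniteMeasure B] : Integrable (quadTest g c) B :=
  Integrable.of_bound (continuous_quadTest hg c).aestronglyMeasurable 1 (ae_of_all _ fun b => by
    rw [quadTest, Real.norm_eq_abs, abs_of_nonneg (hg0 _)]; exact hg1 _)

/-- A single replacement. Carrying `|x|²` in the second coordinate removes the diagonal, so that the
new summand enters through `2⟨w, x⟩ / c` only; this is the origin of the factor `2 / c`. -/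
theorem abs_integral_quadTest_sub_le {B : Measure (E × ℝ)} [IsProbabilityMeasure B]
    (hB : Integrable (fun x => ‖x‖ ^ (2 + δ)) (B.map (ContinuousLinearMap.fst ℝ E ℝ)))
    (hμ : IsCentredVec δ μ s) (hν : IsCentredVec δ ν s) (h0 : 0 ≤ δ) (hg : Continuous g)
    (hg0 : ∀ x, 0 ≤ g x) (hg1 : ∀ x, g x ≤ 1)
    (hT : ∀ a y, |g (a + y) - g a - g₁ a * y - g₂ a * y ^ 2| ≤ C * |y| ^ (2 + δ))
    {c : ℝ} (hc : 0 < c) :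
    |∫ b, quadTest g c b ∂(B ∗ withNormSq μ) - ∫ b, quadTest g c b ∂(B ∗ withNormSq ν)|
      ≤ C * (2 / c) ^ (2 + δ) * (pairMoment δ (B.map (ContinuousLinearMap.fst ℝ E ℝ)) μ
        + pairMoment δ (B.map (ContinuousLinearMap.fst ℝ E ℝ)) ν) := by
  have hmf : AEMeasurable (ContinuousLinearMap.fst ℝ E ℝ) B := by fun_prop
  have := Measure.isProbabilityMeasure_map hmf
  have expand : ∀ {τ : Measure E}, IsCentredVec δ τ s →
      ∫ b, quadTest g c b ∂(B ∗ withNormSq τ)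
        = ∫ b, ∫ x, g ((‖b.1‖ ^ 2 - b.2) / c + 2 / c * inner ℝ b.1 x) ∂τ ∂B := by
    intro τ hτ
    have := hτ.prob
    rw [integral_conv (integrable_quadTest hg hg0 hg1 c _)]
    refine integral_congr_ae (ae_of_all _ fun b => ?_)
    simp only
    rw [withNormSq, integral_map (by fun_prop) (by
      have := continuous_quadTest (E := E) hg c
      fun_prop)]
    refine integral_congr_ae (ae_of_all _ fun x => ?_)
    simp only [quadTest, Prod.fst_add, Prod.snd_add]
    rw [norm_add_sq_real]
    congr 1
    ring
  have hint : ∀ {τ : Measure E}, IsCentredVec δ τ s → Integrable (fun b : E × ℝ =>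
      ∫ x, g ((‖b.1‖ ^ 2 - b.2) / c + 2 / c * inner ℝ b.1 x) ∂τ) B := by
    intro τ hτ
    have := hτ.prob
    refine Integrable.integral_prod_left (f := fun p : (E × ℝ) × E =>
      g ((‖p.1.1‖ ^ 2 - p.1.2) / c + 2 / c * inner ℝ p.1.1 p.2)) ?_
    refine Integrable.of_bound (by fun_prop) 1 (ae_of_all _ fun b => by
      rw [Real.norm_eq_abs, abs_of_nonneg (hg0 _)]; exact hg1 _)
  have hpm : ∀ {τ : Measure E}, IsCentredVec δ τ s →
      Integrable (fun b : E × ℝ => ∫ x, |inner ℝ b.1 x| ^ (2 + δ) ∂τ) B ∧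
      ∫ b : E × ℝ, ∫ x, |inner ℝ b.1 x| ^ (2 + δ) ∂τ ∂B
        = pairMoment δ (B.map (ContinuousLinearMap.fst ℝ E ℝ)) τ := by
    intro τ hτ
    have := hτ.prob
    have i1 := integrable_integral_inner_rpow h0 hτ.int hB
    constructor
    · have := (integrable_map_measure i1.1 hmf).1 i1
      simpa [Function.comp_def, real_inner_comm] using this
    · rw [pairMoment_comm h0 hB hτ.int, pairMoment, integral_map hmf i1.1]
      simp [real_inner_comm]
  have := hμ.prob
  have := hν.prob
  rw [expand hμ, expand hν, ← integral_sub (hint hμ) (hint hν), ← (hpm hμ).2, ← (hpm hν).2,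
    ← integral_add (hpm hμ).1 (hpm hν).1, ← integral_const_mul]
  refine (Real.norm_eq_abs _).symm.trans_le (norm_integral_le_of_norm_le
    (((hpm hμ).1.add (hpm hν).1).const_mul _) (ae_of_all _ fun b => ?_))
  have a1 := abs_integral_taylor_le hμ h0 hg hg0 hg1 hT ((‖b.1‖ ^ 2 - b.2) / c) (2 / c)
    (by positivity) b.1
  have a2 := abs_integral_taylor_le hν h0 hg hg0 hg1 hT ((‖b.1‖ ^ 2 - b.2) / c) (2 / c)
    (by positivity) b.1
  rw [Real.norm_eq_abs, abs_le]
  rw [abs_le] at a1 a2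
  constructor <;> linarith [a1.1, a1.2, a2.1, a2.2]

/-- Telescoping over hybrids with `k` summands of law `μ` and `n - k` of law `ν`; consecutive
hybrids share the law `B` of the other `n - 1` summands. -/
theorem abs_integral_quadTest_convPow_sub_le (hμ : IsCentredVec δ μ s)
    (hν : IsCentredVec δ ν s) (h0 : 0 ≤ δ) (h1 : δ ≤ 1) (hg : Continuous g)
    (hg0 : ∀ x, 0 ≤ g x) (hg1 : ∀ x, g x ≤ 1) (hC : 0 ≤ C)
    (hT : ∀ a y, |g (a + y) - g a - g₁ a * y - g₂ a * y ^ 2| ≤ C * |y| ^ (2 + δ))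
    {c : ℝ} (hc : 0 < c) (n : ℕ) :
    |∫ b, quadTest g c b ∂(convPow (withNormSq μ) n)
        - ∫ b, quadTest g c b ∂(convPow (withNormSq ν) n)|
      ≤ n * (C * (2 / c) ^ (2 + δ) * (11 * (n ^ (1 + δ / 2) *
          (∫ x, s x ^ (1 + δ / 2) ∂μ + ∫ x, s x ^ (1 + δ / 2) ∂ν)
        + n * (pairMoment δ μ μ + pairMoment δ ν μ + pairMoment δ μ ν + pairMoment δ ν ν)))) := by
  have := hμ.prob
  have := hν.prob
  set H : ℕ → ℝ := fun k => ∫ b, quadTest g c b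
    ∂(convPow (withNormSq μ) k ∗ convPow (withNormSq ν) (n - k)) with hH
  set D := C * (2 / c) ^ (2 + δ) * (11 * (n ^ (1 + δ / 2) *
          (∫ x, s x ^ (1 + δ / 2) ∂μ + ∫ x, s x ^ (1 + δ / 2) ∂ν)
        + n * (pairMoment δ μ μ + pairMoment δ ν μ + pairMoment δ μ ν + pairMoment δ ν ν))) with hD
  have hn : ∫ b, quadTest g c b ∂(convPow (withNormSq μ) n) = H n := by
    simp [hH, convPow]
  have hz : ∫ b, quadTest g c b ∂(convPow (withNormSq ν) n) = H 0 := by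
    simp [hH, convPow]
  have step : ∀ k ∈ Finset.range n, |H (k + 1) - H k| ≤ D := by
    intro k hk
    have hk := Finset.mem_range.1 hk
    obtain ⟨l, rfl⟩ : ∃ l, n = k + 1 + l := ⟨n - (k + 1), by omega⟩
    set B := convPow (withNormSq μ) k ∗ convPow (withNormSq ν) l with hBdef
    have hB1 : H (k + 1) = ∫ b, quadTest g c b ∂(B ∗ withNormSq μ) := by
      simp only [hH, hBdef]
      rw [show k + 1 + l - (k + 1) = l by omega, convPow_succ, Measure.conv_assoc,
        Measure.conv_assoc, Measure.conv_comm (withNormSq μ)]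
    have hB0 : H k = ∫ b, quadTest g c b ∂(B ∗ withNormSq ν) := by
      simp only [hH, hBdef]
      rw [show k + 1 + l - k = l + 1 by omega, convPow_succ, Measure.conv_assoc]
    have hBm : B.map (ContinuousLinearMap.fst ℝ E ℝ) = convPow μ k ∗ convPow ν l := by
      rw [hBdef, Measure.map_conv_continuousLinearMap, convPow_map, convPow_map,
        withNormSq_map_fst, withNormSq_map_fst]
    have hBi : Integrable (fun x => ‖x‖ ^ (2 + δ)) (B.map (ContinuousLinearMap.fst ℝ E ℝ)) := by
      rw [hBm]
      exact integrable_norm_rpow_conv h0 h1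
        (integrable_norm_rpow_convPow h0 h1 hμ.int k) (integrable_norm_rpow_convPow h0 h1 hν.int l)
    rw [hB1, hB0]
    refine (abs_integral_quadTest_sub_le hBi hμ hν h0 hg hg0 hg1 hT hc).trans ?_
    rw [hBm, hD]
    have p1 := pairMoment_convPow_le hμ hν hμ h0 h1 (k := k) (l := l) (n := k + 1 + l) (by omega)
    have p2 := pairMoment_convPow_le hμ hν hν h0 h1 (k := k) (l := l) (n := k + 1 + l) (by omega)
    gcongr
    linarith
  rw [hn, hz, ← Finset.sum_range_sub]
  refine (Finset.abs_sum_le_sum_abs _ _).trans ((Finset.sum_le_sum step).trans (le_of_eq ?_))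
  simp

end Lindeberg

/-! ### Gaussian vectors -/

section Gauss

variable {ι : Type*} [Fintype ι]

theorem map_eval_stdGauss (j : ι) :
    (stdGauss ι).map (fun ξ => ξ j) = gaussianReal 0 1 :=
  (measurePreserving_eval (fun _ : ι => gaussianReal 0 1) j).map_eq

theorem integral_eval_stdGauss (j : ι) {φ : ℝ → ℝ} (hφ : Measurable φ) :
    ∫ ξ, φ (ξ j) ∂(stdGauss ι) = ∫ x, φ x ∂(gaussianReal 0 1) := by
  rw [← map_eval_stdGauss j, integral_map (measurable_pi_apply j).aemeasurable hφ.aestronglyMeasurable]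

theorem integrable_eval_stdGauss (j : ι) {φ : ℝ → ℝ} (hφ : Integrable φ (gaussianReal 0 1)) :
    Integrable (fun ξ => φ (ξ j)) (stdGauss ι) := by
  rw [← map_eval_stdGauss j] at hφ
  exact hφ.comp_measurable (by fun_prop)

theorem integrable_abs_rpow_gaussianReal {v : NNReal} {q : ℝ} (hq : 0 ≤ q) :
    Integrable (fun x => |x| ^ q) (gaussianReal 0 v) := by
  have := (memLp_id_gaussianReal' (μ := 0) (v := v) (ENNReal.ofReal q)
    ENNReal.ofReal_ne_top).integrable_norm_rpow'
  simpa [ENNReal.toReal_ofReal hq] using this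

theorem integrable_pow_gaussianReal (v : NNReal) (n : ℕ) :
    Integrable (fun x => x ^ n) (gaussianReal 0 v) := by
  refine (integrable_abs_rpow_gaussianReal (v := v) (q := n) (by positivity)).mono'
    (by fun_prop) (ae_of_all _ fun x => ?_)
  simp

theorem integral_sq_gaussianReal (v : NNReal) : ∫ x, x ^ 2 ∂(gaussianReal 0 v) = v := by
  have := variance_fun_id_gaussianReal (μ := 0) (v := v)
  rwa [variance_of_integral_eq_zero (by fun_prop) integral_id_gaussianReal] at this

/-- The absolute moment of order `2 + δ` of a standard normal variable. -/
noncomputable def gaussMoment (δ : ℝ) : ℝ := ∫ x, |x| ^ (2 + δ) ∂(gaussianReal 0 1)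

theorem integral_abs_rpow_gaussianReal {δ : ℝ} (h0 : 0 ≤ δ) {v : ℝ} (hv : 0 ≤ v) :
    ∫ x, |x| ^ (2 + δ) ∂(gaussianReal 0 v.toNNReal) = v ^ (1 + δ / 2) * gaussMoment δ := by
  have e : gaussianReal 0 v.toNNReal = (gaussianReal 0 1).map (fun x => √v * x) := by
    rw [gaussianReal_map_const_mul]
    congr 1
    · simp
    · ext; simp [Real.sq_sqrt hv, Real.coe_toNNReal _ hv]
  rw [e, integral_map (by fun_prop) (by fun_prop (disch := linarith)), gaussMoment,
    ← integral_const_mul]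
  refine integral_congr_ae (ae_of_all _ fun x => ?_)
  simp only [abs_mul]
  rw [Real.mul_rpow (abs_nonneg _) (abs_nonneg _), abs_of_nonneg (Real.sqrt_nonneg v),
    Real.sqrt_eq_rpow, ← Real.rpow_mul hv]
  congr 2
  ring

theorem map_linear_stdGauss (a : ι → ℝ) :
    (stdGauss ι).map (fun ξ => ∑ j, a j * ξ j) = gaussianReal 0 (∑ j, a j ^ 2).toNNReal := by
  have hm : AEMeasurable (fun ξ : ι → ℝ => ∑ j, a j * ξ j) (stdGauss ι) :=
    (by fun_prop : Measurable _).aemeasurable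
  have := Measure.isProbabilityMeasure_map hm
  refine Measure.ext_of_charFun ?_
  ext t
  rw [charFun_apply_real, integral_map hm (by fun_prop), charFun_gaussianReal]
  have e : ∀ ξ : ι → ℝ, Complex.exp (t * (∑ j, a j * ξ j : ℝ) * Complex.I)
      = ∏ j, Complex.exp ((t * a j : ℝ) * (ξ j : ℝ) * Complex.I) := fun ξ => by
    rw [← Complex.exp_sum]
    congr 1
    push_cast
    rw [Finset.mul_sum, Finset.sum_mul]
    exact Finset.sum_congr rfl fun j _ => by ring
  simp_rw [e]
  rw [integral_fintype_prod_eq_prod (𝕜 := ℂ)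
    (f := fun j (x : ℝ) => Complex.exp ((t * a j : ℝ) * (x : ℝ) * Complex.I))]
  have e2 : ∀ j, ∫ x : ℝ, Complex.exp ((t * a j : ℝ) * (x : ℝ) * Complex.I) ∂(gaussianReal 0 1)
      = Complex.exp (-(t ^ 2 * a j ^ 2 / 2)) := fun j => by
    rw [← charFun_apply_real, charFun_gaussianReal]
    congr 1
    push_cast
    simp
    ring
  simp_rw [e2]
  rw [← Complex.exp_sum, Real.coe_toNNReal _ (Finset.sum_nonneg fun j _ => sq_nonneg _)]
  congr 1
  push_cast
  rw [Finset.sum_neg_distrib, ← Finset.sum_div, ← Finset.mul_sum]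
  ring

/-- The fourth-moment constant `E (ξ² - 1)²` of a standard normal variable. -/
noncomputable def gaussKurt : ℝ := ∫ x, (x ^ 2 - 1) ^ 2 ∂(gaussianReal 0 1)

theorem memLp_sq_sub_one : MemLp (fun x : ℝ => x ^ 2 - 1) 2 (gaussianReal 0 1) := by
  rw [memLp_two_iff_integrable_sq (by fun_prop)]
  have e : ∀ x : ℝ, (x ^ 2 - 1) ^ 2 = x ^ 4 - 2 * x ^ 2 + 1 := fun x => by ring
  simp_rw [e]
  exact ((integrable_pow_gaussianReal 1 4).sub ((integrable_pow_gaussianReal 1 2).const_mul 2)).add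
    (integrable_const 1)

theorem memLp_eval_sq_sub_one (j : ι) (c : ℝ) :
    MemLp (fun ξ : ι → ℝ => c * (ξ j ^ 2 - 1)) 2 (stdGauss ι) := by
  have h := (memLp_sq_sub_one.const_mul c)
  rw [← map_eval_stdGauss j] at h
  exact h.comp_of_map (measurable_pi_apply j).aemeasurable

theorem integral_chiSum (a : ι → ℝ) : ∫ ξ, chiSum a ξ ∂(stdGauss ι) = 0 := by
  unfold chiSum
  rw [integral_finsetSum _ fun j _ => (memLp_eval_sq_sub_one j (a j)).integrable (by norm_num)]
  refine Finset.sum_eq_zero fun j _ => ?_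
  rw [integral_eval_stdGauss j (φ := fun x => a j * (x ^ 2 - 1)) (by fun_prop),
    integral_const_mul, integral_sub (integrable_pow_gaussianReal 1 2) (integrable_const 1),
    integral_sq_gaussianReal]
  simp

theorem memLp_chiSum (a : ι → ℝ) : MemLp (chiSum a) 2 (stdGauss ι) :=
  memLp_finsetSum _ fun j _ => memLp_eval_sq_sub_one j (a j)

theorem integral_chiSum_sq (a : ι → ℝ) :
    ∫ ξ, chiSum a ξ ^ 2 ∂(stdGauss ι) = gaussKurt * ∑ j, a j ^ 2 := by
  rw [← variance_of_integral_eq_zero (continuous_chiSum a).measurable.aemeasurable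
    (integral_chiSum a)]
  have e : chiSum a = ∑ j, fun ξ : ι → ℝ => a j * (ξ j ^ 2 - 1) := by
    ext ξ; simp [chiSum]
  rw [e, variance_sum_pi (X := fun j x => a j * (x ^ 2 - 1))
    (fun j => memLp_sq_sub_one.const_mul (a j)), Finset.mul_sum]
  refine Finset.sum_congr rfl fun j _ => ?_
  rw [variance_const_mul, variance_of_integral_eq_zero (by fun_prop), gaussKurt, mul_comm]
  rw [integral_sub (integrable_pow_gaussianReal 1 2) (integrable_const 1),
    integral_sq_gaussianReal]
  simp

variable {E : Type*} [NormedAddCommGroup E] [InnerProductSpace ℝ E] [FiniteDimensional ℝ E]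
  [MeasurableSpace E] [BorelSpace E] (u : OrthonormalBasis ι ℝ E) (lam : ι → ℝ)

/-- The vector with independent normal coordinates of variances `lam j` in the basis `u`. -/
noncomputable def gaussVec (ξ : ι → ℝ) : E := ∑ j, (√(lam j) * ξ j) • u j

/-- The centred Gaussian measure with covariance `∑ j, lam j • u j ⊗ u j`. -/
noncomputable def gaussMeasure : Measure E := (stdGauss ι).map (gaussVec u lam)

/-- The quadratic form with eigenvalues `lam j` in the basis `u`. -/
noncomputable def covForm (w : E) : ℝ := ∑ j, lam j * inner ℝ w (u j) ^ 2

theorem continuous_gaussVec : Continuous (gaussVec u lam) := by unfold gaussVec; fun_prop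

theorem continuous_covForm : Continuous (covForm u lam) := by unfold covForm; fun_prop

instance : IsProbabilityMeasure (gaussMeasure u lam) :=
  Measure.isProbabilityMeasure_map (continuous_gaussVec u lam).aemeasurable

variable {lam}

theorem inner_gaussVec (w : E) (ξ : ι → ℝ) :
    inner ℝ w (gaussVec u lam ξ) = ∑ j, (√(lam j) * inner ℝ w (u j)) * ξ j := by
  rw [gaussVec, inner_sum]
  refine Finset.sum_congr rfl fun j _ => ?_
  rw [inner_smul_right]; ring

theorem inner_gaussVec_basis (ξ : ι → ℝ) (j : ι) :
    inner ℝ (gaussVec u lam ξ) (u j) = √(lam j) * ξ j := by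
  classical
  rw [real_inner_comm, inner_gaussVec]
  rw [Finset.sum_eq_single j]
  · rw [orthonormal_iff_ite.1 u.orthonormal]; simp
  · intro i _ hi
    rw [orthonormal_iff_ite.1 u.orthonormal]; simp [hi.symm]
  · simp

theorem covForm_gaussVec (hl : ∀ j, 0 ≤ lam j) (ξ : ι → ℝ) :
    covForm u lam (gaussVec u lam ξ) = ∑ j, lam j ^ 2 * ξ j ^ 2 := by
  rw [covForm]
  refine Finset.sum_congr rfl fun j _ => ?_
  rw [inner_gaussVec_basis, mul_pow, Real.sq_sqrt (hl j)]
  ring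

theorem norm_sq_gaussVec (hl : ∀ j, 0 ≤ lam j) (ξ : ι → ℝ) :
    ‖gaussVec u lam ξ‖ ^ 2 = ∑ j, lam j * ξ j ^ 2 := by
  rw [← u.sum_sq_norm_inner_left]
  refine Finset.sum_congr rfl fun j _ => ?_
  rw [inner_gaussVec_basis, Real.norm_eq_abs, sq_abs, mul_pow, Real.sq_sqrt (hl j)]

theorem gaussMeasure_map_inner (hl : ∀ j, 0 ≤ lam j) (w : E) :
    (gaussMeasure u lam).map (innerSL ℝ w) = gaussianReal 0 (covForm u lam w).toNNReal := by
  rw [gaussMeasure, Measure.map_map (innerSL ℝ w).continuous.measurable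
    (continuous_gaussVec u lam).measurable]
  have e : (innerSL ℝ w) ∘ (gaussVec u lam)
      = fun ξ => ∑ j, (√(lam j) * inner ℝ w (u j)) * ξ j := by
    ext ξ; simp [inner_gaussVec]
  rw [e, map_linear_stdGauss]
  refine congrArg (fun v : ℝ => gaussianReal 0 v.toNNReal) (Finset.sum_congr rfl fun j _ => ?_)
  rw [mul_pow, Real.sq_sqrt (hl j)]

theorem covForm_nonneg (hl : ∀ j, 0 ≤ lam j) (w : E) : 0 ≤ covForm u lam w :=
  Finset.sum_nonneg fun j _ => mul_nonneg (hl j) (sq_nonneg _)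

theorem integrable_norm_rpow_gaussMeasure {q : ℝ} (hq : 0 ≤ q) :
    Integrable (fun x => ‖x‖ ^ q) (gaussMeasure u lam) := by
  have h : MemLp (gaussVec u lam) (ENNReal.ofReal q) (stdGauss ι) := by
    refine memLp_finsetSum _ fun j _ => ?_
    have h1 : MemLp (fun ξ : ι → ℝ => ξ j) (ENNReal.ofReal q) (stdGauss ι) := by
      have := memLp_id_gaussianReal' (μ := 0) (v := 1) (ENNReal.ofReal q) ENNReal.ofReal_ne_top
      rw [← map_eval_stdGauss j] at this
      exact this.comp_of_map (measurable_pi_apply j).aemeasurable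
    refine (h1.norm.const_mul (√(lam j) * ‖u j‖)).mono'
      (by fun_prop : Continuous _).aestronglyMeasurable (ae_of_all _ fun ξ => ?_)
    rw [norm_smul, norm_mul, Real.norm_of_nonneg (Real.sqrt_nonneg _)]
    exact le_of_eq (by ring)
  have h2 := h.integrable_norm_rpow'
  rw [ENNReal.toReal_ofReal hq] at h2
  rw [gaussMeasure, integrable_map_measure (by fun_prop)
    (continuous_gaussVec u lam).aemeasurable]
  exact h2

theorem isCentredVec_gaussMeasure {δ : ℝ} (h0 : 0 ≤ δ) (hl : ∀ j, 0 ≤ lam j) :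
    IsCentredVec δ (gaussMeasure u lam) (covForm u lam) where
  prob := inferInstance
  int := integrable_norm_rpow_gaussMeasure u (by linarith)
  mean w := by
    have := integral_map (μ := gaussMeasure u lam) (innerSL ℝ w).continuous.aemeasurable
      (f := fun x : ℝ => x) (by fun_prop)
    rw [gaussMeasure_map_inner u hl, integral_id_gaussianReal] at this
    simpa using this.symm
  var w := by
    have := integral_map (μ := gaussMeasure u lam) (innerSL ℝ w).continuous.aemeasurable
      (f := fun x : ℝ => x ^ 2) (by fun_prop)
    rw [gaussMeasure_map_inner u hl, integral_sq_gaussianReal,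
      Real.coe_toNNReal _ (covForm_nonneg u hl w)] at this
    simpa using this.symm
  cont := continuous_covForm u lam

/-- Given `x`, the pairing with the Gaussian vector is `N(0, s x)`. Every pair moment with a
Gaussian factor thus reduces to a moment of the covariance form. -/
theorem pairMoment_gaussMeasure {δ : ℝ} (h0 : 0 ≤ δ) (hl : ∀ j, 0 ≤ lam j) (μ : Measure E) :
    pairMoment δ (gaussMeasure u lam) μ
      = gaussMoment δ * ∫ x, covForm u lam x ^ (1 + δ / 2) ∂μ := by
  rw [pairMoment, ← integral_const_mul]
  refine integral_congr_ae (ae_of_all _ fun x => ?_)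
  simp only
  have := IsCentredVec.integral_map_inner (ν := gaussMeasure u lam) x h0
  rw [gaussMeasure_map_inner u hl, integral_abs_rpow_gaussianReal h0 (covForm_nonneg u hl x)]
    at this
  simp_rw [real_inner_comm] at this ⊢
  rw [← this, mul_comm]

theorem gaussMoment_nonneg (δ : ℝ) : 0 ≤ gaussMoment δ :=
  integral_nonneg fun x => by positivity

/-- At the Gaussian vector the covariance form is `f²` times the average of the `ξⱼ²` with weights
`λⱼ²/f²`. Jensen's inequality for this average makes the bound independent of the dimension. -/
theorem integral_covForm_rpow_gaussMeasure_le {δ : ℝ} (h0 : 0 ≤ δ) (hl : ∀ j, 0 ≤ lam j)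
    {f : ℝ} (hf : 0 < f) (hf2 : ∑ j, lam j ^ 2 = f ^ 2) :
    ∫ x, covForm u lam x ^ (1 + δ / 2) ∂(gaussMeasure u lam) ≤ f ^ (2 + δ) * gaussMoment δ := by
  have hc := continuous_covForm u lam
  rw [gaussMeasure, integral_map (continuous_gaussVec u lam).aemeasurable
    (hc.rpow_const fun x => Or.inr (by linarith)).aestronglyMeasurable]
  simp_rw [covForm_gaussVec u hl]
  have hi : ∀ j, Integrable (fun ξ : ι → ℝ => |ξ j| ^ (2 + δ)) (stdGauss ι) := fun j =>
    integrable_eval_stdGauss j (integrable_abs_rpow_gaussianReal (by linarith))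
  have hs : Integrable (fun ξ : ι → ℝ => f ^ (2 + δ) * ∑ j, lam j ^ 2 / f ^ 2 * |ξ j| ^ (2 + δ))
      (stdGauss ι) :=
    (integrable_finsetSum _ fun j _ => (hi j).const_mul _).const_mul _
  have hw : ∑ j, lam j ^ 2 / f ^ 2 = 1 := by
    rw [← Finset.sum_div, hf2, div_self (by positivity)]
  have e : f ^ (2 + δ) = (f ^ 2) ^ (1 + δ / 2) := by
    rw [← Real.rpow_natCast, ← Real.rpow_mul hf.le]
    congr 1; push_cast; ring
  calc ∫ ξ, (∑ j, lam j ^ 2 * ξ j ^ 2) ^ (1 + δ / 2) ∂(stdGauss ι)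
      ≤ ∫ ξ, f ^ (2 + δ) * ∑ j, lam j ^ 2 / f ^ 2 * |ξ j| ^ (2 + δ) ∂(stdGauss ι) := by
        refine integral_mono_of_nonneg (ae_of_all _ fun ξ => ?_) hs (ae_of_all _ fun ξ => ?_)
        · exact Real.rpow_nonneg (Finset.sum_nonneg fun j _ => by positivity) _
        · have h1 := Real.rpow_arith_mean_le_arith_mean_rpow Finset.univ
            (fun j => lam j ^ 2 / f ^ 2) (fun j => ξ j ^ 2) (fun j _ => by positivity) hw
            (fun j _ => sq_nonneg _) (p := 1 + δ / 2) (by linarith)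
          have h2 : ∀ j, (ξ j ^ 2) ^ (1 + δ / 2) = |ξ j| ^ (2 + δ) := fun j => by
            rw [← sq_abs, ← Real.rpow_natCast, ← Real.rpow_mul (abs_nonneg _)]
            congr 1; push_cast; ring
          simp_rw [h2] at h1
          refine le_trans (le_of_eq ?_) (mul_le_mul_of_nonneg_left h1
            (by positivity : 0 ≤ f ^ (2 + δ)))
          rw [e, ← Real.mul_rpow (by positivity) (Finset.sum_nonneg fun j _ => by positivity),
            Finset.mul_sum]
          refine congrArg (· ^ (1 + δ / 2)) (Finset.sum_congr rfl fun j _ => ?_)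
          field_simp
    _ = f ^ (2 + δ) * gaussMoment δ := by
        rw [integral_const_mul, integral_finsetSum _ fun j _ => (hi j).const_mul _]
        simp_rw [integral_const_mul]
        have : ∀ j : ι, ∫ ξ : ι → ℝ, |ξ j| ^ (2 + δ) ∂(stdGauss ι) = gaussMoment δ := fun j =>
          integral_eval_stdGauss j (φ := fun x => |x| ^ (2 + δ)) (by fun_prop)
        simp_rw [this]
        rw [← Finset.sum_mul, hw, one_mul]

/-- Jensen, since the covariance form has mean `∑ λⱼ² = f²`. This lower bound lets the purely
Gaussian contributions, of order `f^q`, be absorbed into the moment of the original vectors. -/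
theorem le_integral_covForm_rpow {δ : ℝ} (h0 : 0 ≤ δ) {μ : Measure E}
    (hμ : IsCentredVec δ μ (covForm u lam)) {f : ℝ} (hf : 0 < f)
    (hf2 : ∑ j, lam j ^ 2 = f ^ 2) :
    f ^ (2 + δ) ≤ ∫ x, covForm u lam x ^ (1 + δ / 2) ∂μ := by
  classical
  have := hμ.prob
  have i1 : ∀ j, Integrable (fun x => lam j * inner ℝ x (u j) ^ 2) μ := fun j => by
    have := (hμ.map_inner h0 (u j)).integrable_sq h0
    have := (integrable_map_measure (by fun_prop)
      (innerSL ℝ (u j)).continuous.aemeasurable).1 this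
    refine Integrable.const_mul ?_ _
    simpa [Function.comp_def, real_inner_comm] using this
  have i2 : Integrable (covForm u lam) μ := integrable_finsetSum _ fun j _ => i1 j
  have e1 : ∫ x, covForm u lam x ∂μ = f ^ 2 := by
    unfold covForm
    rw [integral_finsetSum _ fun j _ => i1 j, ← hf2]
    refine Finset.sum_congr rfl fun j _ => ?_

    have hc : ∀ x, inner ℝ x (u j) = inner ℝ (u j) x := fun x => real_inner_comm _ _
    simp_rw [hc]
    rw [integral_const_mul, hμ.var, covForm, Finset.sum_eq_single j]
    · rw [orthonormal_iff_ite.1 u.orthonormal]; simp [sq]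
    · intro i _ hi
      rw [orthonormal_iff_ite.1 u.orthonormal]; simp [hi.symm]
    · simp
  have e : f ^ (2 + δ) = (f ^ 2) ^ (1 + δ / 2) := by
    rw [← Real.rpow_natCast, ← Real.rpow_mul hf.le]
    congr 1; push_cast; ring
  rw [e, ← e1]
  exact (convexOn_rpow (p := 1 + δ / 2) (by linarith)).map_integral_le
    (Real.continuous_rpow_const (by linarith)).continuousOn isClosed_Ici
    (ae_of_all _ fun x => hμ.var_nonneg x) i2 (hμ.integrable_var_rpow hμ h0)

end Gauss

/-! ### Convolution powers of Gaussian measures and the Gaussian quadratic form. -/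

theorem IsCentred.convPow {δ v : ℝ} {μ : Measure ℝ} (h : IsCentred δ μ v) (h0 : 0 ≤ δ)
    (h1 : δ ≤ 1) (n : ℕ) : IsCentred δ (convPow μ n) (n * v) := by
  induction n with
  | zero => simpa [UStat.convPow] using IsCentred.dirac_zero (δ := δ)
  | succ n ih =>
    have := ih.conv h h0 h1
    rw [convPow_succ]
    convert this using 1
    push_cast; ring

theorem convPow_map_add (ρ : Measure ℝ) [IsProbabilityMeasure ρ] (a : ℝ) (n : ℕ) :
    convPow (ρ.map (· + a)) n = (convPow ρ n).map (· + n * a) := by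
  induction n with
  | zero => simp [convPow]
  | succ n ih =>
    have := Measure.isProbabilityMeasure_map (μ := ρ) (f := (· + a)) (by fun_prop)
    rw [convPow_succ, ih, convPow_succ, ← Measure.conv_dirac, ← Measure.conv_dirac,
      ← Measure.conv_dirac, Measure.conv_assoc, ← Measure.conv_assoc (Measure.dirac _),
      Measure.conv_comm (Measure.dirac _) ρ, Measure.conv_assoc ρ, Measure.dirac_conv_dirac,
      Measure.conv_assoc]
    congr 3
    push_cast; ring

section Gauss

variable {ι : Type*} [Fintype ι]
  {E : Type*} [NormedAddCommGroup E] [InnerProductSpace ℝ E] [FiniteDimensional ℝ E]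
  [MeasurableSpace E] [BorelSpace E] (u : OrthonormalBasis ι ℝ E) {lam : ι → ℝ}

theorem charFun_gaussMeasure (hl : ∀ j, 0 ≤ lam j) (w : E) :
    charFun (gaussMeasure u lam) w = Complex.exp (-(covForm u lam w : ℂ) / 2) := by
  have h := charFun_gaussianReal (μ := 0) (v := (covForm u lam w).toNNReal) 1
  rw [← gaussMeasure_map_inner u hl, charFun_apply_real,
    integral_map (innerSL ℝ w).continuous.aemeasurable (by fun_prop)] at h
  rw [charFun_apply]
  simp only [innerSL_apply_apply, Complex.ofReal_one, one_mul] at h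
  simp_rw [real_inner_comm w]
  rw [h, Real.coe_toNNReal _ (covForm_nonneg u hl w)]
  congr 1
  push_cast
  ring

theorem convPow_gaussMeasure (hl : ∀ j, 0 ≤ lam j) (n : ℕ) :
    convPow (gaussMeasure u lam) n = (gaussMeasure u lam).map (fun x => √(n : ℝ) • x) := by
  have := Measure.isProbabilityMeasure_map (μ := gaussMeasure u lam)
    (f := fun x => √(n : ℝ) • x) (by fun_prop)
  refine Measure.ext_of_charFun ?_
  ext w
  rw [charFun_map_smul, charFun_gaussMeasure u hl]
  have e : covForm u lam (√(n : ℝ) • w) = n * covForm u lam w := by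
    simp only [covForm, real_inner_smul_left, mul_pow, Real.sq_sqrt (Nat.cast_nonneg n)]
    rw [Finset.mul_sum]
    exact Finset.sum_congr rfl fun j _ => by ring
  rw [e]
  induction n with
  | zero => simp [convPow]
  | succ n ih =>
    have := Measure.isProbabilityMeasure_map (μ := gaussMeasure u lam)
      (f := fun x => √(n : ℝ) • x) (by fun_prop)
    have e' : covForm u lam (√(n : ℝ) • w) = n * covForm u lam w := by
      simp only [covForm, real_inner_smul_left, mul_pow, Real.sq_sqrt (Nat.cast_nonneg n)]
      rw [Finset.mul_sum]
      exact Finset.sum_congr rfl fun j _ => by ring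
    rw [convPow_succ, charFun_conv, ih this e', charFun_gaussMeasure u hl, ← Complex.exp_add]
    congr 1
    push_cast
    ring

theorem norm_sq_gaussVec_sub (hl : ∀ j, 0 ≤ lam j) (ξ : ι → ℝ) :
    ‖gaussVec u lam ξ‖ ^ 2 - ∑ j, lam j = chiSum lam ξ := by
  rw [norm_sq_gaussVec u hl, chiSum, ← Finset.sum_sub_distrib]
  exact Finset.sum_congr rfl fun j _ => by ring

/-- The exponent parameter is `0` because only the variance of `|Z|²` is needed to control the
fluctuation of the diagonal. -/
theorem isCentred_norm_sq_gaussMeasure (hl : ∀ j, 0 ≤ lam j) :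
    IsCentred 0 (((withNormSq (gaussMeasure u lam)).map (ContinuousLinearMap.snd ℝ E ℝ)).map
      (· + -∑ j, lam j)) (gaussKurt * ∑ j, lam j ^ 2) := by
  have hg := (continuous_gaussVec u lam).measurable
  have e : ((withNormSq (gaussMeasure u lam)).map (ContinuousLinearMap.snd ℝ E ℝ)).map
      (· + -∑ j, lam j) = (stdGauss ι).map (chiSum lam) := by
    rw [withNormSq, gaussMeasure, Measure.map_map (by fun_prop) (by fun_prop),
      Measure.map_map (by fun_prop) (by fun_prop), Measure.map_map (by fun_prop) hg]
    congr 1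
    ext ξ
    rw [← norm_sq_gaussVec_sub u hl]
    simp [sub_eq_add_neg]
  have hm : AEMeasurable (chiSum lam) (stdGauss ι) :=
    (continuous_chiSum lam).measurable.aemeasurable
  rw [e]
  refine ⟨Measure.isProbabilityMeasure_map hm, ?_, ?_, ?_⟩
  · rw [integrable_map_measure (by fun_prop (disch := norm_num)) hm]
    simpa [Function.comp_def] using (memLp_chiSum lam).integrable_sq
  · rw [integral_map hm (by fun_prop), integral_chiSum]
  · rw [integral_map hm (by fun_prop), integral_chiSum_sq]

/-- The sum of `n` Gaussian copies is distributed as `√n Z`, so the normalised squared norm has the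
limiting law exactly, for every `n ≥ 1`. -/
theorem convPow_withNormSq_gaussMeasure_map (hl : ∀ j, 0 ≤ lam j) {f : ℝ} {n : ℕ} (hn : n ≠ 0) :
    (convPow (withNormSq (gaussMeasure u lam)) n).map
      (fun b => (‖b.1‖ ^ 2 / n - ∑ j, lam j) / f)
      = (stdGauss ι).map (chiSum fun j => lam j / f) := by
  have hg := (continuous_gaussVec u lam).measurable
  have e : (convPow (withNormSq (gaussMeasure u lam)) n).map
      (fun b => (‖b.1‖ ^ 2 / n - ∑ j, lam j) / f)
      = ((convPow (withNormSq (gaussMeasure u lam)) n).map (ContinuousLinearMap.fst ℝ E ℝ)).map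
        (fun w => (‖w‖ ^ 2 / n - ∑ j, lam j) / f) := by
    rw [Measure.map_map (by fun_prop) (by fun_prop)]; rfl
  rw [e, convPow_map, withNormSq_map_fst, convPow_gaussMeasure u hl, gaussMeasure,
    Measure.map_map (by fun_prop) hg, Measure.map_map (by fun_prop) (by fun_prop)]
  congr 1
  ext ξ
  have h1 : (‖√(n : ℝ) • gaussVec u lam ξ‖ ^ 2 / n - ∑ j, lam j) / f = chiSum lam ξ / f := by
    rw [← norm_sq_gaussVec_sub u hl, norm_smul, mul_pow, Real.norm_eq_abs, sq_abs,
      Real.sq_sqrt (Nat.cast_nonneg n)]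
    have : (n : ℝ) ≠ 0 := by exact_mod_cast hn
    field_simp
  simp only [Function.comp_apply]
  rw [h1, chiSum, chiSum, Finset.sum_div]
  exact Finset.sum_congr rfl fun j _ => by ring

theorem gaussKurt_nonneg : 0 ≤ gaussKurt := integral_nonneg fun _ => sq_nonneg _

theorem abs_le_sq_div_add {y a : ℝ} (ha : 0 < a) : |y| ≤ y ^ 2 / a + a := by
  rw [← sub_nonneg]
  have : y ^ 2 / a + a - |y| = ((|y| - a) ^ 2 + |y| * a) / a := by
    rw [← sq_abs]; field_simp; ring
  rw [this]
  positivity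

/-- With `v = (|W|²/n - tr)/f` and `y` the centred sum of the `|Zᵢ|²`, the form equals `v + v/(n-1)
- y/((n-1) f)`. Here `v` has the law of `V`, and `E y²` is of order `n f²`, so the two corrections
are `O(1/n)` and `O(n^{-1/2})` in mean. -/
theorem abs_integral_quadTest_gauss_sub_le (hl : ∀ j, 0 ≤ lam j) {f : ℝ} (hf : 0 < f)
    (hf2 : ∑ j, lam j ^ 2 = f ^ 2) {g : ℝ → ℝ} (hg : Continuous g)
    (hg0 : ∀ x, 0 ≤ g x) (hg1 : ∀ x, g x ≤ 1) {K : ℝ} (hK : 0 ≤ K)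
    (hL : ∀ x y, |g x - g y| ≤ K * |x - y|) {n : ℕ} (hn : 2 ≤ n) :
    |∫ b, quadTest g ((n - 1) * f) b ∂(convPow (withNormSq (gaussMeasure u lam)) n)
      - ∫ ξ, g (chiSum (fun j => lam j / f) ξ) ∂(stdGauss ι)|
      ≤ K * (4 * (gaussKurt + 1) / √n) := by
  set P := convPow (withNormSq (gaussMeasure u lam)) n with hP
  set tr := ∑ j, lam j with htr
  have hn0 : (2 : ℝ) ≤ n := by exact_mod_cast hn
  set v : E × ℝ → ℝ := fun b => (‖b.1‖ ^ 2 / n - tr) / f with hv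
  set y : E × ℝ → ℝ := fun b => b.2 + n * -tr with hy
  have hvm : Measurable v := by fun_prop
  have hym : Measurable y := by fun_prop
  have lawv : P.map v = (stdGauss ι).map (chiSum fun j => lam j / f) :=
    convPow_withNormSq_gaussMeasure_map u hl (by omega)
  have lawy : IsCentred 0 (P.map y) (n * (gaussKurt * f ^ 2)) := by
    have h := (isCentred_norm_sq_gaussMeasure u hl).convPow le_rfl zero_le_one n
    have := Measure.isProbabilityMeasure_map (μ := withNormSq (gaussMeasure u lam))
      (f := ContinuousLinearMap.snd ℝ E ℝ) (by fun_prop)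
    rw [convPow_map_add, ← convPow_map, Measure.map_map (by fun_prop) (by fun_prop), hf2] at h
    exact h
  have hcm := (continuous_chiSum fun j => lam j / f).measurable
  have ev : ∫ ξ, g (chiSum (fun j => lam j / f) ξ) ∂(stdGauss ι) = ∫ b, g (v b) ∂P := by
    rw [← integral_map (φ := chiSum fun j => lam j / f) (f := g) hcm.aemeasurable
      hg.aestronglyMeasurable, ← lawv, integral_map hvm.aemeasurable hg.aestronglyMeasurable]
  have iv : Integrable (fun b => v b ^ 2) P ∧ ∫ b, v b ^ 2 ∂P = gaussKurt := by
    have i1 : Integrable (fun x : ℝ => x ^ 2) (P.map v) := by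
      rw [lawv, integrable_map_measure (by fun_prop) hcm.aemeasurable]
      exact (memLp_chiSum _).integrable_sq
    refine ⟨(integrable_map_measure (by fun_prop) hvm.aemeasurable).1 i1, ?_⟩
    rw [← integral_map (φ := v) (f := fun x => x ^ 2) hvm.aemeasurable (by fun_prop), lawv,
      integral_map hcm.aemeasurable (by fun_prop), integral_chiSum_sq]
    simp_rw [div_pow]
    rw [← Finset.sum_div, hf2, div_self (by positivity), mul_one]
  have iy : Integrable (fun b => y b ^ 2) P ∧ ∫ b, y b ^ 2 ∂P = n * (gaussKurt * f ^ 2) := by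
    refine ⟨(integrable_map_measure (by fun_prop) hym.aemeasurable).1
      (lawy.integrable_sq le_rfl), ?_⟩
    rw [← lawy.var, integral_map hym.aemeasurable (by fun_prop)]
  have hs : 0 < √(n : ℝ) := Real.sqrt_pos.2 (by linarith)
  have hss : √(n : ℝ) ^ 2 = n := Real.sq_sqrt (by linarith)
  have hs1 : 1 ≤ √(n : ℝ) := Real.one_le_sqrt.2 (by linarith)
  have hn1 : (0 : ℝ) < n - 1 := by linarith
  have igv : Integrable (fun b => g (v b)) P :=
    Integrable.of_bound (hg.measurable.comp hvm).aestronglyMeasurable 1 (ae_of_all _ fun b => by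
      rw [Real.norm_eq_abs, abs_of_nonneg (hg0 _)]; exact hg1 _)
  have ibnd : Integrable (fun b => K * ((v b ^ 2 + 1) / (n - 1)
      + (y b ^ 2 / (√n * f) + √n * f) / ((n - 1) * f))) P :=
    (((iv.1.add (integrable_const 1)).div_const _).add
      (((iy.1.div_const _).add (integrable_const _)).div_const _)).const_mul _
  rw [ev, ← integral_sub (integrable_quadTest hg hg0 hg1 _ _) igv]
  refine (Real.norm_eq_abs _).symm.trans_le ((norm_integral_le_of_norm_le ibnd
    (ae_of_all _ fun b => ?_)).trans ?_)
  · rw [Real.norm_eq_abs, quadTest]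
    refine (hL _ _).trans ?_
    have e : (‖b.1‖ ^ 2 - b.2) / ((n - 1) * f) - v b = v b / (n - 1) - y b / ((n - 1) * f) := by
      simp only [hv, hy]
      field_simp
      ring
    rw [e]
    have t1 : |v b| ≤ v b ^ 2 + 1 := by simpa using abs_le_sq_div_add (y := v b) one_pos
    -- The split point `√n f` is the order of the standard deviation of `y`, which balances the two
    -- terms.
    have t2 : |y b| ≤ y b ^ 2 / (√n * f) + √n * f := abs_le_sq_div_add (by positivity)
    gcongr
    refine (abs_sub _ _).trans ?_
    rw [abs_div (v b), abs_div (y b), abs_of_pos hn1, abs_of_pos (by positivity : 0 < (n - 1) * f)]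
    gcongr
  · have j1 : Integrable (fun b => (v b ^ 2 + 1) / ((n : ℝ) - 1)) P :=
      (iv.1.add (integrable_const 1)).div_const _
    have j2 : Integrable (fun b => y b ^ 2 / (√n * f)) P := iy.1.div_const _
    have j3 : Integrable (fun b => (y b ^ 2 / (√n * f) + √n * f) / ((n - 1) * f)) P :=
      (j2.add (integrable_const _)).div_const _
    rw [integral_const_mul, integral_add j1 j3, integral_div, integral_div,
      integral_add iv.1 (integrable_const 1), integral_add j2 (integrable_const _),
      integral_div, iv.2, iy.2]
    simp only [integral_const, probReal_univ, smul_eq_mul, one_mul]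
    have hk := gaussKurt_nonneg
    have e : (gaussKurt + 1) / ((n : ℝ) - 1)
        + (n * (gaussKurt * f ^ 2) / (√n * f) + √n * f) / ((n - 1) * f)
        = (gaussKurt + 1) * ((1 + √n) / (n - 1)) := by
      nth_rewrite 2 [← hss]
      field_simp
    rw [e]
    rw [mul_comm 4, mul_div_assoc]
    have h2 : 0 ≤ gaussKurt + 1 := by linarith
    refine mul_le_mul_of_nonneg_left (mul_le_mul_of_nonneg_left ?_ h2) hK
    rw [div_le_div_iff₀ hn1 hs]
    nlinarith

end Gauss

/-! ### Comparison of distribution functions -/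

theorem measureReal_Iic_le_integral {P : Measure ℝ} [IsProbabilityMeasure P] {g : ℝ → ℝ}
    (hg : Continuous g) (h1 : ∀ x ≤ 0, g x = 1) (hg0 : ∀ x, 0 ≤ g x) (hg1 : ∀ x, g x ≤ 1)
    {ψ : ℝ} (hψ : 0 < ψ) (t : ℝ) : P.real (Set.Iic t) ≤ ∫ x, g (ψ * (x - t)) ∂P := by
  rw [← integral_indicator_one measurableSet_Iic]
  refine integral_mono ((integrable_const (1 : ℝ)).indicator measurableSet_Iic)
    (Integrable.of_bound (by fun_prop) 1 (ae_of_all _ fun x => by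
      rw [Real.norm_eq_abs, abs_of_nonneg (hg0 _)]; exact hg1 _)) fun x => ?_
  by_cases hx : x ∈ Set.Iic t
  · rw [Set.indicator_of_mem hx]
    simp only [Pi.one_apply]
    rw [h1 _ (mul_nonpos_of_nonneg_of_nonpos hψ.le (sub_nonpos.2 hx))]
  · rw [Set.indicator_of_notMem hx]; exact hg0 _

theorem integral_le_measureReal_Iic {P : Measure ℝ} [IsProbabilityMeasure P] {g : ℝ → ℝ}
    (hg : Continuous g) (h0 : ∀ x, 1 ≤ x → g x = 0) (hg0 : ∀ x, 0 ≤ g x) (hg1 : ∀ x, g x ≤ 1)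
    {ψ : ℝ} (hψ : 0 < ψ) (t : ℝ) : ∫ x, g (ψ * (x - t)) ∂P ≤ P.real (Set.Iic (t + 1 / ψ)) := by
  rw [← integral_indicator_one measurableSet_Iic]
  refine integral_mono (Integrable.of_bound (by fun_prop) 1 (ae_of_all _ fun x => by
      rw [Real.norm_eq_abs, abs_of_nonneg (hg0 _)]; exact hg1 _))
      ((integrable_const (1 : ℝ)).indicator measurableSet_Iic) fun x => ?_
  by_cases hx : x ∈ Set.Iic (t + 1 / ψ)
  · rw [Set.indicator_of_mem hx]; exact hg1 _
  · rw [Set.indicator_of_notMem hx]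
    refine le_of_eq (h0 _ ?_)
    rw [Set.mem_Iic, not_le] at hx
    have : 1 / ψ ≤ x - t := by linarith
    rwa [div_le_iff₀' hψ] at this

/-- The indicator of `(-∞, t]` lies between the cutoffs started at `t - 1/ψ` and at `t`. The shift
by `1/ψ` is paid for under `Q` alone, so no concentration of `P` is required. -/
theorem abs_measureReal_Iic_sub_le {P Q : Measure ℝ} [IsProbabilityMeasure P]
    [IsProbabilityMeasure Q] {g : ℝ → ℝ} (hg : Continuous g) (h1 : ∀ x ≤ 0, g x = 1)
    (h0 : ∀ x, 1 ≤ x → g x = 0) (hg0 : ∀ x, 0 ≤ g x) (hg1 : ∀ x, g x ≤ 1) {ψ ε η : ℝ}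
    (hψ : 0 < ψ) (hε : ∀ t, |∫ x, g (ψ * (x - t)) ∂P - ∫ x, g (ψ * (x - t)) ∂Q| ≤ ε)
    (hη : ∀ t, Q.real {x | |x - t| ≤ 1 / ψ} ≤ η) (t : ℝ) :
    |P.real (Set.Iic t) - Q.real (Set.Iic t)| ≤ ε + η := by
  have hw : 0 < 1 / ψ := by positivity
  have inc : ∀ t, Q.real (Set.Iic (t + 1 / ψ)) ≤ Q.real (Set.Iic t) + η := fun t => by
    refine (measureReal_mono (s₂ := Set.Iic t ∪ {x | |x - t| ≤ 1 / ψ}) fun x hx => ?_).trans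
      ((measureReal_union_le _ _).trans (by gcongr; exact hη t))
    rcases le_total x t with h | h
    · exact Or.inl h
    · refine Or.inr ?_
      rw [Set.mem_Iic] at hx
      rw [Set.mem_ofPred_eq, abs_of_nonneg (by linarith)]
      linarith
  rw [abs_le]
  constructor
  · have a1 := integral_le_measureReal_Iic (P := P) hg h0 hg0 hg1 hψ (t - 1 / ψ)
    have a2 := measureReal_Iic_le_integral (P := Q) hg h1 hg0 hg1 hψ (t - 1 / ψ)
    have a3 := inc (t - 1 / ψ)
    have a4 := (abs_le.1 (hε (t - 1 / ψ))).1
    rw [sub_add_cancel] at a1 a3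
    linarith
  · have a1 := measureReal_Iic_le_integral (P := P) hg h1 hg0 hg1 hψ t
    have a2 := integral_le_measureReal_Iic (P := Q) hg h0 hg0 hg1 hψ t
    have a3 := inc t
    have a4 := (abs_le.1 (hε t)).2
    linarith

/-- Here `704 = 64 · 11`: `n - 1 ≥ n/2` and `q ≤ 3` give `4³`, and `11` is the Rosenthal constant.
The terms `pᵢ` join `A` since `n ≤ n^{1+δ/2}`, and `(1 + κ)³` dominates the resulting `1 + 3κ + κ²`.
-/
theorem lindeberg_constant_le {δ f A A' D p₁ p₂ p₃ κ : ℝ} (h0 : 0 ≤ δ) (h1 : δ ≤ 1)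
    (hf : 0 < f) (hA : 0 ≤ A) (hD : 0 ≤ D) (hκ : 0 ≤ κ) (hA' : A' ≤ κ * A)
    (hp₁ : p₁ ≤ κ * A) (hp₂ : p₂ ≤ κ * A) (hp₃ : p₃ ≤ κ ^ 2 * A) {C : ℝ} (hC : 0 ≤ C)
    {n : ℕ} (hn : 2 ≤ n) :
    n * (C * (2 / ((n - 1) * f)) ^ (2 + δ) * (11 * (n ^ (1 + δ / 2) * (A + A')
        + n * (D + p₁ + p₂ + p₃))))
      ≤ 704 * (1 + κ) ^ 3 * (C * (A / (n ^ (δ / 2) * f ^ (2 + δ)) + D / f ^ (2 + δ) / n ^ δ)) := by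
  have hn0 : (2 : ℝ) ≤ n := by exact_mod_cast hn
  have hnp : (0 : ℝ) < n := by linarith
  have hn1 : (0 : ℝ) < n - 1 := by linarith
  have e1 : (2 / ((n - 1) * f)) ^ (2 + δ) ≤ 64 / (n ^ (2 + δ) * f ^ (2 + δ)) := by
    have : 2 / (((n : ℝ) - 1) * f) ≤ 4 / (n * f) := by
      rw [div_le_div_iff₀ (by positivity) (by positivity)]
      nlinarith
    calc (2 / (((n : ℝ) - 1) * f)) ^ (2 + δ) ≤ (4 / (n * f)) ^ (2 + δ) := by gcongr
      _ = 4 ^ (2 + δ) / (n ^ (2 + δ) * f ^ (2 + δ)) := by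
        rw [Real.div_rpow (by norm_num) (by positivity), Real.mul_rpow hnp.le hf.le]
      _ ≤ 4 ^ (3 : ℝ) / (n ^ (2 + δ) * f ^ (2 + δ)) := by
        gcongr
        · norm_num
        · linarith
      _ = _ := by norm_num
  have e2 : (n : ℝ) ≤ n ^ (1 + δ / 2) := by
    conv_lhs => rw [← Real.rpow_one (n : ℝ)]
    exact Real.rpow_le_rpow_of_exponent_le (by linarith) (by linarith)
  have hk1 : 1 ≤ (1 + κ) ^ 3 := one_le_pow₀ (by linarith)
  have e3 : (n : ℝ) ^ (1 + δ / 2) * (A + A') + n * (D + p₁ + p₂ + p₃)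
      ≤ (1 + κ) ^ 3 * (n ^ (1 + δ / 2) * A + n * D) := by
    have s1 : (n : ℝ) * (p₁ + p₂ + p₃) ≤ n ^ (1 + δ / 2) * ((2 * κ + κ ^ 2) * A) := by
      calc (n : ℝ) * (p₁ + p₂ + p₃) ≤ n * ((2 * κ + κ ^ 2) * A) := by gcongr; linarith
        _ ≤ _ := by gcongr
    have s2 : (n : ℝ) ^ (1 + δ / 2) * A' ≤ n ^ (1 + δ / 2) * (κ * A) := by gcongr
    have s3 : (n : ℝ) * D ≤ (1 + κ) ^ 3 * (n * D) := le_mul_of_one_le_left (by positivity) hk1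
    have s4 : (n : ℝ) ^ (1 + δ / 2) * A * (1 + 3 * κ + κ ^ 2)
        ≤ n ^ (1 + δ / 2) * A * (1 + κ) ^ 3 := by
      gcongr
      nlinarith [pow_nonneg hκ 3, sq_nonneg κ]
    nlinarith
  have r1 : (n : ℝ) ^ (2 + δ) = n * n ^ (1 + δ / 2) * n ^ (δ / 2) := by
    rw [mul_assoc, ← Real.rpow_add hnp]
    nth_rewrite 2 [← Real.rpow_one (n : ℝ)]
    rw [← Real.rpow_add hnp]
    congr 1; ring
  have r2 : (n : ℝ) ^ (2 + δ) = n * n * n ^ δ := by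
    rw [Real.rpow_add hnp, Real.rpow_two]; ring
  calc n * (C * (2 / ((n - 1) * f)) ^ (2 + δ) * (11 * (n ^ (1 + δ / 2) * (A + A')
        + n * (D + p₁ + p₂ + p₃))))
      ≤ n * (C * (2 / ((n - 1) * f)) ^ (2 + δ) * (11 * ((1 + κ) ^ 3 *
          (n ^ (1 + δ / 2) * A + n * D)))) := by gcongr
    _ ≤ n * (C * (64 / (n ^ (2 + δ) * f ^ (2 + δ))) * (11 * ((1 + κ) ^ 3 *
          (n ^ (1 + δ / 2) * A + n * D)))) := by gcongr
    _ = 704 * (1 + κ) ^ 3 * (C * (n * n ^ (1 + δ / 2) * A / (n ^ (2 + δ) * f ^ (2 + δ))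
          + n * n * D / (n ^ (2 + δ) * f ^ (2 + δ)))) := by ring
    _ = _ := by
        congr 3
        · rw [r1]; field_simp
        · rw [r2]; field_simp

/-- The Lindeberg ratio of a measure with covariance form `s`. -/
noncomputable def lindebergRatio {E : Type*} [NormedAddCommGroup E] [InnerProductSpace ℝ E]
    [MeasurableSpace E] (δ : ℝ) (n : ℕ) (f : ℝ) (s : E → ℝ) (μ : Measure E) : ℝ :=
  (∫ x, s x ^ (1 + δ / 2) ∂μ) / (n ^ (δ / 2) * f ^ (2 + δ))
    + pairMoment δ μ μ / f ^ (2 + δ) / n ^ δ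

/-- The scale `ψ` is left free. The cutoff `g (ψ (x - t))` has Taylor constant `K ψ^q` and Lipschitz
constant `K ψ`, whence the replacement error and the Gaussian error; the last term is the mass of
`V` in a window of radius `1/ψ`. The constant depends on `δ` only. -/
theorem exists_kolmogorov_bound {δ : ℝ} (h0 : 0 ≤ δ) (h1 : δ ≤ 1) : ∃ C : ℝ, 0 < C ∧
    ∀ (ι : Type) [Fintype ι] (E : Type) [NormedAddCommGroup E] [InnerProductSpace ℝ E]
      [FiniteDimensional ℝ E] [MeasurableSpace E] [BorelSpace E] (u : OrthonormalBasis ι ℝ E)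
      (lam : ι → ℝ) (f : ℝ) (μ : Measure E) (n : ℕ) (ψ t : ℝ), (∀ j, 0 ≤ lam j) → 0 < f →
      ∑ j, lam j ^ 2 = f ^ 2 → IsCentredVec δ μ (covForm u lam) → 2 ≤ n → 0 < ψ →
      |(convPow (withNormSq μ) n).real {b | (‖b.1‖ ^ 2 - b.2) / ((n - 1) * f) ≤ t}
        - (stdGauss ι).real {ξ | chiSum (fun j => lam j / f) ξ ≤ t}|
      ≤ C * (ψ ^ (2 + δ) * lindebergRatio δ n f (covForm u lam) μ + ψ / √n
        + ψ ^ (-(1 / 2) : ℝ)) := by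
  obtain ⟨g, g₁, g₂, K, hK, hg, gone, gzero, hg0, hg1, hgL, hgT⟩ := exists_smooth_cutoff
  obtain ⟨C₁, hC₁, hconc⟩ := exists_chiSum_concentration
  have hκ := gaussMoment_nonneg δ
  have hk := gaussKurt_nonneg
  set κ := gaussMoment δ
  refine ⟨704 * (1 + κ) ^ 3 * K + K * (4 * (gaussKurt + 1)) + C₁, by positivity, ?_⟩
  intro ι _ E _ _ _ _ _ u lam f μ n ψ t hl hf hf2 hμ hn hψ
  have := hμ.prob
  have hn0 : (2 : ℝ) ≤ n := by exact_mod_cast hn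
  have hc : 0 < ((n : ℝ) - 1) * f := mul_pos (by linarith) hf
  have hZ := isCentredVec_gaussMeasure u h0 hl
  set A := ∫ x, covForm u lam x ^ (1 + δ / 2) ∂μ with hAdef
  have hA : 0 ≤ A := integral_nonneg fun x => Real.rpow_nonneg (covForm_nonneg u hl x) _
  have hD : 0 ≤ pairMoment δ μ μ :=
    integral_nonneg fun x => integral_nonneg fun w => by positivity
  have hA' : ∫ x, covForm u lam x ^ (1 + δ / 2) ∂(gaussMeasure u lam) ≤ κ * A := by
    refine (integral_covForm_rpow_gaussMeasure_le u h0 hl hf hf2).trans ?_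
    rw [mul_comm]
    gcongr
    exact le_integral_covForm_rpow u h0 hμ hf hf2
  have hp₁ := pairMoment_gaussMeasure u h0 hl μ
  have hp₃ := pairMoment_gaussMeasure u h0 hl (gaussMeasure u lam)
  have hp₂ : pairMoment δ μ (gaussMeasure u lam) = κ * A := by
    rw [pairMoment_comm h0 hμ.int hZ.int, hp₁]
  have hL0 : 0 ≤ lindebergRatio δ n f (covForm u lam) μ := by
    unfold lindebergRatio; positivity
  set L := lindebergRatio δ n f (covForm u lam) μ with hLdef
  have hRm : Measurable fun b : E × ℝ => (‖b.1‖ ^ 2 - b.2) / ((n - 1) * f) := by fun_prop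
  have hVm := (continuous_chiSum fun j => lam j / f).measurable
  set P := (convPow (withNormSq μ) n).map fun b => (‖b.1‖ ^ 2 - b.2) / ((n - 1) * f) with hP
  set Q := (stdGauss ι).map (chiSum fun j => lam j / f) with hQ
  have := Measure.isProbabilityMeasure_map (μ := convPow (withNormSq μ) n) hRm.aemeasurable
  have := Measure.isProbabilityMeasure_map (μ := stdGauss ι) hVm.aemeasurable
  have eP : (convPow (withNormSq μ) n).real {b | (‖b.1‖ ^ 2 - b.2) / ((n - 1) * f) ≤ t}
      = P.real (Set.Iic t) := by
    rw [hP, map_measureReal_apply hRm measurableSet_Iic]; rfl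
  have eQ : (stdGauss ι).real {ξ | chiSum (fun j => lam j / f) ξ ≤ t} = Q.real (Set.Iic t) := by
    rw [hQ, map_measureReal_apply hVm measurableSet_Iic]; rfl
  rw [eP, eQ]
  have hη : ∀ t, Q.real {x | |x - t| ≤ 1 / ψ} ≤ C₁ * ψ ^ (-(1 / 2) : ℝ) := fun t => by
    have ha : ∑ j, (lam j / f) ^ 2 = 1 := by
      simp_rw [div_pow]
      rw [← Finset.sum_div, hf2, div_self (by positivity)]
    have := hconc ι _ ha t (1 / ψ) (by positivity)
    rw [one_div, Real.inv_rpow hψ.le, ← Real.rpow_neg hψ.le, ← one_div] at this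
    rw [hQ, map_measureReal_apply hVm (measurableSet_le (by fun_prop) measurable_const)]
    exact this
  have hε : ∀ t, |∫ x, g (ψ * (x - t)) ∂P - ∫ x, g (ψ * (x - t)) ∂Q|
      ≤ 704 * (1 + κ) ^ 3 * (K * ψ ^ (2 + δ) * L) + K * ψ * (4 * (gaussKurt + 1) / √n) := by
    intro t
    set G : ℝ → ℝ := fun x => g (ψ * (x - t)) with hG
    have hGc : Continuous G := by fun_prop
    have hT : ∀ a y, |G (a + y) - G a - (ψ * g₁ (ψ * (a - t))) * y
        - (ψ ^ 2 * g₂ (ψ * (a - t))) * y ^ 2| ≤ K * ψ ^ (2 + δ) * |y| ^ (2 + δ) := fun a y => by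
      have := hgT (2 + δ) (by linarith) (by linarith) (ψ * (a - t)) (ψ * y)
      rw [abs_mul, abs_of_pos hψ, Real.mul_rpow hψ.le (abs_nonneg _)] at this
      simp only [hG]
      rw [show ψ * (a + y - t) = ψ * (a - t) + ψ * y by ring, mul_assoc K]
      refine le_trans (le_of_eq ?_) this
      congr 1
      ring
    have hLip : ∀ x y, |G x - G y| ≤ K * ψ * |x - y| := fun x y => by
      refine (hgL _ _).trans (le_of_eq ?_)
      rw [← mul_sub, sub_sub_sub_cancel_right, abs_mul, abs_of_pos hψ, mul_assoc]
    have b1 := abs_integral_quadTest_convPow_sub_le hμ hZ h0 h1 hGc (fun x => hg0 _)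
      (fun x => hg1 _) (C := K * ψ ^ (2 + δ)) (by positivity)
      (g₁ := fun a => ψ * g₁ (ψ * (a - t))) (g₂ := fun a => ψ ^ 2 * g₂ (ψ * (a - t))) hT hc n
    have b2 := lindeberg_constant_le h0 h1 hf hA hD hκ hA' hp₁.le hp₂.le
      (p₃ := pairMoment δ (gaussMeasure u lam) (gaussMeasure u lam)) (by
        rw [hp₃, sq, mul_assoc]; gcongr) (C := K * ψ ^ (2 + δ)) (by positivity) hn
    have b3 := abs_integral_quadTest_gauss_sub_le u hl hf hf2 hGc (fun x => hg0 _)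
      (fun x => hg1 _) (K := K * ψ) (by positivity) hLip hn
    have i1 : ∫ x, G x ∂P = ∫ b, quadTest G ((n - 1) * f) b ∂(convPow (withNormSq μ) n) := by
      rw [hP, integral_map hRm.aemeasurable hGc.aestronglyMeasurable]; rfl
    have i2 : ∫ x, G x ∂Q = ∫ ξ, G (chiSum (fun j => lam j / f) ξ) ∂(stdGauss ι) := by
      rw [hQ, integral_map hVm.aemeasurable hGc.aestronglyMeasurable]
    rw [i1, i2]
    exact (abs_sub_le _ _ _).trans (add_le_add (b1.trans b2) b3)
  refine (abs_measureReal_Iic_sub_le hg gone gzero hg0 hg1 hψ hε hη t).trans ?_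
  have q1 : 0 ≤ ψ ^ (2 + δ) * L := by positivity
  have q2 : 0 ≤ ψ / √(n : ℝ) := by positivity
  have q3 : 0 ≤ ψ ^ (-(1 / 2) : ℝ) := by positivity
  have e : 704 * (1 + κ) ^ 3 * (K * ψ ^ (2 + δ) * L) + K * ψ * (4 * (gaussKurt + 1) / √n)
      + C₁ * ψ ^ (-(1 / 2) : ℝ) = (704 * (1 + κ) ^ 3 * K) * (ψ ^ (2 + δ) * L)
        + (K * (4 * (gaussKurt + 1))) * (ψ / √n) + C₁ * ψ ^ (-(1 / 2) : ℝ) := by ring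
  rw [e]
  have w1 : 0 ≤ 704 * (1 + κ) ^ 3 * K := by positivity
  have w2 : 0 ≤ K * (4 * (gaussKurt + 1)) := by positivity
  refine le_trans (add_le_add (add_le_add (mul_le_mul_of_nonneg_right ?_ q1)
    (mul_le_mul_of_nonneg_right ?_ q2)) (mul_le_mul_of_nonneg_right ?_ q3)) (le_of_eq
      (show _ = _ by rw [← mul_add, ← mul_add])) <;> linarith

/-! ### From the random vectors to their laws -/

/-- The vectors `w` with `⟨w, X⟩ ∈ L^q` form a subspace `S`, and by Fubini almost every value of `X`
lies in `S`. Hence `⟨w, X⟩ = ⟨P_S w, X⟩` almost surely for every `w`, so all coordinates of `X` are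
in `L^q`. -/
theorem integrable_norm_rpow_of_integrable_inner_rpow {E : Type*} [NormedAddCommGroup E]
    [InnerProductSpace ℝ E] [FiniteDimensional ℝ E] [MeasurableSpace E] [BorelSpace E]
    {ν : Measure E} [IsProbabilityMeasure ν] {q : ℝ} (hq : 1 ≤ q)
    (h : Integrable (fun p : E × E => |inner ℝ p.1 p.2| ^ q) (ν.prod ν)) :
    Integrable (fun x => ‖x‖ ^ q) ν := by
  have hq0 : 0 ≤ q := by linarith
  have hne : ENNReal.ofReal q ≠ 0 := by
    rw [ne_eq, ENNReal.ofReal_eq_zero, not_le]; linarith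
  have hiff : ∀ w : E, MemLp (fun x => inner ℝ w x) (ENNReal.ofReal q) ν ↔
      Integrable (fun x => |inner ℝ w x| ^ q) ν := fun w => by
    have := integrable_norm_rpow_iff (μ := ν) (f := fun x => inner ℝ w x)
      (by fun_prop) hne ENNReal.ofReal_ne_top
    rw [ENNReal.toReal_ofReal hq0] at this
    exact this.symm
  let S : Submodule ℝ E :=
    { carrier := {w | MemLp (fun x => inner ℝ w x) (ENNReal.ofReal q) ν}
      add_mem' := fun {a b} ha hb => by
        have ha' : MemLp (fun x => inner ℝ a x) (ENNReal.ofReal q) ν := ha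
        have hb' : MemLp (fun x => inner ℝ b x) (ENNReal.ofReal q) ν := hb
        show MemLp (fun x => inner ℝ (a + b) x) (ENNReal.ofReal q) ν
        simp_rw [inner_add_left]
        exact ha'.add hb'
      zero_mem' := by
        show MemLp (fun x => inner ℝ (0 : E) x) (ENNReal.ofReal q) ν
        simp
      smul_mem' := fun c a ha => by
        have ha' : MemLp (fun x => inner ℝ a x) (ENNReal.ofReal q) ν := ha
        show MemLp (fun x => inner ℝ (c • a) x) (ENNReal.ofReal q) ν
        simp_rw [real_inner_smul_left]
        exact ha'.const_mul c }
  have hS : ∀ᵐ x ∂ν, x ∈ S := by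
    filter_upwards [h.prod_right_ae] with w hw
    exact (hiff w).2 hw
  have hall : ∀ w : E, MemLp (fun x => inner ℝ w x) (ENNReal.ofReal q) ν := fun w => by
    have hP : MemLp (fun x => inner ℝ (S.starProjection w) x) (ENNReal.ofReal q) ν :=
      S.starProjection_apply_mem w
    refine hP.ae_eq ?_
    filter_upwards [hS] with x hx
    rw [Submodule.inner_starProjection_left_eq_right, Submodule.starProjection_eq_self_iff.2 hx]
  have hid : MemLp (fun x : E => x) (ENNReal.ofReal q) ν := by
    have e : (fun x : E => x)
        = fun x => ∑ i, inner ℝ (stdOrthonormalBasis ℝ E i) x • stdOrthonormalBasis ℝ E i := by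
      ext x; exact ((stdOrthonormalBasis ℝ E).sum_repr' x).symm
    rw [e]
    refine memLp_finsetSum _ fun i _ => ?_
    refine ((hall (stdOrthonormalBasis ℝ E i)).norm.const_mul
      ‖stdOrthonormalBasis ℝ E i‖).mono' (by fun_prop) (ae_of_all _ fun x => ?_)
    rw [norm_smul, mul_comm]
  have := hid.integrable_norm_rpow'
  rwa [ENNReal.toReal_ofReal hq0] at this

/-! ### Spectral form of the covariance matrix. -/

section Matrices

variable {p : ℕ} {A : Matrix (Fin p) (Fin p) ℝ}

theorem trace_sq_eq_sum_eigenvalues_sq (hA : A.IsHermitian) :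
    (A ^ 2).trace = ∑ j, hA.eigenvalues j ^ 2 := by
  conv_lhs => rw [hA.spectral_theorem]
  rw [← map_pow, Unitary.conjStarAlgAut_apply, Matrix.trace_mul_comm, ← mul_assoc,
    Unitary.coe_star_mul_self, one_mul, Matrix.diagonal_pow, Matrix.trace_diagonal]
  simp

theorem inner_eq_dotProduct (x y : EuclideanSpace ℝ (Fin p)) :
    inner ℝ x y = x.ofLp ⬝ᵥ y.ofLp := by
  rw [EuclideanSpace.inner_eq_star_dotProduct, dotProduct_comm]
  simp

theorem dotProduct_mulVec_eq_covForm (hA : A.IsHermitian) (w : EuclideanSpace ℝ (Fin p)) :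
    w.ofLp ⬝ᵥ (A *ᵥ w.ofLp) = covForm hA.eigenvectorBasis hA.eigenvalues w := by
  have h1 := hA.eigenvectorBasis.sum_inner_mul_inner w (WithLp.toLp 2 (A *ᵥ w.ofLp))
  rw [inner_eq_dotProduct] at h1
  rw [← h1, covForm]
  refine Finset.sum_congr rfl fun j _ => ?_
  have hAt : Aᵀ = A := by
    have := hA.eq
    rwa [Matrix.conjTranspose_eq_transpose_of_trivial] at this
  have h2 : inner ℝ (hA.eigenvectorBasis j) (WithLp.toLp 2 (A *ᵥ w.ofLp))
      = hA.eigenvalues j * inner ℝ w (hA.eigenvectorBasis j) := by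
    rw [inner_eq_dotProduct, Matrix.dotProduct_mulVec, ← Matrix.mulVec_transpose, hAt,
      hA.mulVec_eigenvectorBasis, smul_dotProduct, dotProduct_comm, ← inner_eq_dotProduct,
      smul_eq_mul]
  rw [h2]
  ring

end Matrices

/-! ### Laws of the vectors, of the statistic and of `V`. -/

section OneSample

variable {Ω : Type*} [MeasurableSpace Ω] {p : ℕ} {μ : Measure Ω} [IsProbabilityMeasure μ]

theorem integral_inner_sq_eq {X : Ω → EuclideanSpace ℝ (Fin p)} (hX : MemLp X 2 μ)
    (hmean : ∫ ω, X ω ∂μ = 0) (w : EuclideanSpace ℝ (Fin p)) :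
    ∫ ω, inner ℝ w (X ω) ^ 2 ∂μ = w.ofLp ⬝ᵥ (covMatrix X μ *ᵥ w.ofLp) := by
  have hXi : Integrable X μ := hX.integrable (by norm_num)
  have hc : ∀ j, MemLp (fun ω => X ω j) 2 μ := fun j =>
    hX.mono ((EuclideanSpace.proj (𝕜 := ℝ) j).continuous.comp_aestronglyMeasurable hX.1)
      (ae_of_all _ fun ω => PiLp.norm_apply_le (X ω) j)
  have hm : ∀ j, ∫ ω, X ω j ∂μ = 0 := fun j => by
    have hs : ∀ ω, inner ℝ (EuclideanSpace.single j (1 : ℝ)) (X ω) = X ω j := fun ω => by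
      simp [EuclideanSpace.inner_single_left]
    simpa only [hmean, inner_zero_right, hs] using
      integral_inner (𝕜 := ℝ) hXi (EuclideanSpace.single j (1 : ℝ))
  have hcov : ∀ j k, covMatrix X μ j k = ∫ ω, X ω j * X ω k ∂μ := fun j k => by
    rw [covMatrix, Matrix.of_apply, covariance_eq_sub (hc j) (hc k), hm j, hm k]
    simp
  have hint : ∀ j k, Integrable (fun ω => X ω j * X ω k) μ := fun j k =>
    (hc j).integrable_mul (hc k)
  have e : ∀ ω, inner ℝ w (X ω) ^ 2 = ∑ j, ∑ k, w j * (w k * (X ω j * X ω k)) := fun ω => by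
    rw [inner_eq_dotProduct, dotProduct, sq, Finset.sum_mul_sum]
    refine Finset.sum_congr rfl fun j _ => Finset.sum_congr rfl fun k _ => by ring
  simp_rw [e]
  rw [integral_finsetSum _ fun j _ => integrable_finsetSum _ fun k _ =>
    ((hint j k).const_mul _).const_mul _]
  simp only [dotProduct, Matrix.mulVec, Finset.mul_sum]
  refine Finset.sum_congr rfl fun j _ => ?_
  rw [integral_finsetSum _ fun k _ => ((hint j k).const_mul _).const_mul _]
  refine Finset.sum_congr rfl fun k _ => ?_
  rw [integral_const_mul, integral_const_mul, hcov]
  ring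

theorem frob_pos {X : Ω → EuclideanSpace ℝ (Fin p)} (hf : covMatrix X μ ≠ 0) :
    0 < frob X μ ∧
      ∑ j, (covMatrix_isHermitian X μ).eigenvalues j ^ 2 = frob X μ ^ 2 := by
  have h := trace_sq_eq_sum_eigenvalues_sq (covMatrix_isHermitian X μ)
  have hpos : 0 < ∑ j, (covMatrix_isHermitian X μ).eigenvalues j ^ 2 := by
    refine lt_of_le_of_ne (Finset.sum_nonneg fun j _ => sq_nonneg _) fun h0 => hf ?_
    rw [← (covMatrix_isHermitian X μ).eigenvalues_eq_zero_iff]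
    ext j
    have := (Finset.sum_eq_zero_iff_of_nonneg fun j _ => sq_nonneg _).1 h0.symm j
      (Finset.mem_univ j)
    simpa using this
  constructor
  · rw [frob, h]; exact Real.sqrt_pos.2 hpos
  · rw [frob, h, Real.sq_sqrt hpos.le]

theorem lawV_real_Iic (X : Ω → EuclideanSpace ℝ (Fin p)) (t : ℝ) :
    (lawV X μ).real (Set.Iic t) = (stdGauss (Fin p)).real
      {ξ | chiSum (fun j => (covMatrix_isHermitian X μ).eigenvalues j / frob X μ) ξ ≤ t} := by
  have hprob : IsProbabilityMeasure ((gaussianReal 0 1).map fun x : ℝ => x ^ 2) :=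
    Measure.isProbabilityMeasure_map (by fun_prop)
  have e : lawV X μ = (stdGauss (Fin p)).map
      (chiSum fun j => (covMatrix_isHermitian X μ).eigenvalues j / frob X μ) := by
    rw [lawV]
    unfold chiSqOne
    rw [← Measure.pi_map_pi (fun _ => by fun_prop), Measure.map_map (by fun_prop) (by fun_prop)]
    rfl
  rw [e, map_measureReal_apply (continuous_chiSum _).measurable measurableSet_Iic]
  rfl

theorem Rtilde_eq (n : ℕ) (X : ℕ → Ω → EuclideanSpace ℝ (Fin p)) (ω : Ω) :
    Rtilde n X μ ω = (‖∑ i ∈ Finset.range n, X i ω‖ ^ 2 - ∑ i ∈ Finset.range n, ‖X i ω‖ ^ 2)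
      / (((n : ℝ) - 1) * frob (X 0) μ) := by
  rw [Rtilde]
  congr 1
  rw [← real_inner_self_eq_norm_sq, sum_inner, ← Finset.sum_sub_distrib]
  refine Finset.sum_congr rfl fun i hi => ?_
  rw [inner_sum, ← Finset.add_sum_erase _ _ hi, real_inner_self_eq_norm_sq, add_sub_cancel_left]
  refine Finset.sum_congr ?_ fun _ _ => rfl
  ext j
  simp only [Finset.mem_filter, Finset.mem_erase]
  tauto

/-- This is where independence turns the statistic into a functional of a convolution power, the
form in which the replacement argument is stated. -/
theorem map_sum_withNormSq {X : ℕ → Ω → EuclideanSpace ℝ (Fin p)} (hindep : iIndepFun X μ)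
    (hident : ∀ i, IdentDistrib (X i) (X 0) μ μ) (n : ℕ) :
    μ.map (∑ i ∈ Finset.range n, fun ω => (X i ω, ‖X i ω‖ ^ 2))
      = convPow (withNormSq (μ.map (X 0))) n := by
  have hm : ∀ i, AEMeasurable (X i) μ := fun i => (hident i).aemeasurable_fst
  have hm' : ∀ i, AEMeasurable (fun ω => (X i ω, ‖X i ω‖ ^ 2)) μ := fun i =>
    (hm i).prodMk ((hm i).norm.pow_const 2)
  have hI : iIndepFun (fun i ω => (X i ω, ‖X i ω‖ ^ 2)) μ :=
    hindep.comp₀ (fun _ x => (x, ‖x‖ ^ 2)) hm (fun _ => by fun_prop)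
  induction n with
  | zero => simp [convPow, Pi.zero_def]
  | succ n ih =>
    rw [Finset.sum_range_succ, (hI.indepFun_finsetSum_of_notMem₀ hm'
      Finset.notMem_range_self).map_add_eq_map_conv_map₀
      (Finset.aemeasurable_sum _ fun i _ => hm' i) (hm' n), ih, convPow_succ]
    congr 1
    rw [withNormSq, ← (hident n).map_eq, AEMeasurable.map_map_of_aemeasurable (by fun_prop) (hm n)]
    rfl

theorem measureReal_Rtilde_le {X : ℕ → Ω → EuclideanSpace ℝ (Fin p)} (hindep : iIndepFun X μ)
    (hident : ∀ i, IdentDistrib (X i) (X 0) μ μ) (n : ℕ) (t : ℝ) :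
    μ.real {ω | Rtilde n X μ ω ≤ t} = (convPow (withNormSq (μ.map (X 0))) n).real
      {b | (‖b.1‖ ^ 2 - b.2) / ((n - 1) * frob (X 0) μ) ≤ t} := by
  have hm : ∀ i, AEMeasurable (fun ω => (X i ω, ‖X i ω‖ ^ 2)) μ := fun i =>
    (hident i).aemeasurable_fst.prodMk ((hident i).aemeasurable_fst.norm.pow_const 2)
  rw [← map_sum_withNormSq hindep hident n, measureReal_def, measureReal_def,
    Measure.map_apply_of_aemeasurable (Finset.aemeasurable_sum _ fun i _ => hm i)
      (measurableSet_le (by fun_prop) measurable_const)]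
  congr 2
  ext ω
  simp only [Set.mem_ofPred_eq, Set.mem_preimage, Rtilde_eq, Finset.sum_apply, Prod.fst_sum,
    Prod.snd_sum]

theorem map_pair_eq_prod {X : ℕ → Ω → EuclideanSpace ℝ (Fin p)} (hindep : iIndepFun X μ)
    (hident : ∀ i, IdentDistrib (X i) (X 0) μ μ) :
    μ.map (fun ω => (X 0 ω, X 1 ω)) = (μ.map (X 0)).prod (μ.map (X 0)) := by
  rw [(hindep.indepFun (by norm_num : (0 : ℕ) ≠ 1)).map_prod_eq_prod_map_map
    (hident 0).aemeasurable_fst (hident 1).aemeasurable_fst, (hident 1).map_eq]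

/-- The law of one of the vectors satisfies the hypotheses of the comparison theorem, and its
moments are those in the definition of `Ldagger`. -/
theorem law_facts {δ : ℝ} (h0 : 0 ≤ δ) {X : ℕ → Ω → EuclideanSpace ℝ (Fin p)}
    (hindep : iIndepFun X μ) (hident : ∀ i, IdentDistrib (X i) (X 0) μ μ)
    (hL2 : MemLp (X 0) 2 μ) (hmean : ∫ ω, X 0 ω ∂μ = 0) (hf : covMatrix (X 0) μ ≠ 0)
    (hD : Integrable (fun ω => |inner ℝ (X 0 ω) (X 1 ω) / frob (X 0) μ| ^ (2 + δ)) μ) :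
    IsCentredVec δ (μ.map (X 0)) (covForm (covMatrix_isHermitian (X 0) μ).eigenvectorBasis
        (covMatrix_isHermitian (X 0) μ).eigenvalues) ∧
      pairMoment δ (μ.map (X 0)) (μ.map (X 0)) / frob (X 0) μ ^ (2 + δ)
        = DConst δ (X 0) (X 1) μ ^ (2 + δ) ∧ 0 ≤ DConst δ (X 0) (X 1) μ := by
  have hq : 0 ≤ 2 + δ := by linarith
  have hfp := (frob_pos (μ := μ) hf).1
  have hm : ∀ i, AEMeasurable (X i) μ := fun i => (hident i).aemeasurable_fst
  have hm2 : AEMeasurable (fun ω => (X 0 ω, X 1 ω)) μ := (hm 0).prodMk (hm 1)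
  have := Measure.isProbabilityMeasure_map (hm 0)
  have hpair := map_pair_eq_prod hindep hident
  have hfq : 0 < frob (X 0) μ ^ (2 + δ) := by positivity
  have ediv : ∀ ω, |inner ℝ (X 0 ω) (X 1 ω) / frob (X 0) μ| ^ (2 + δ)
      = |inner ℝ (X 0 ω) (X 1 ω)| ^ (2 + δ) / frob (X 0) μ ^ (2 + δ) := fun ω => by
    rw [abs_div, abs_of_pos hfp, Real.div_rpow (abs_nonneg _) hfp.le]
  have hi : Integrable (fun b : EuclideanSpace ℝ (Fin p) × EuclideanSpace ℝ (Fin p) =>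
      |inner ℝ b.1 b.2| ^ (2 + δ)) ((μ.map (X 0)).prod (μ.map (X 0))) := by
    rw [← hpair, integrable_map_measure (by fun_prop (disch := linarith)) hm2]
    refine (hD.mul_const (frob (X 0) μ ^ (2 + δ))).congr (ae_of_all _ fun ω => ?_)
    simp only [Function.comp_apply]
    rw [ediv, div_mul_cancel₀ _ hfq.ne']
  -- The moment of order `q` of `|X₁|` is not assumed; it follows from that of `X₁ᵀX₂`.
  have hint := integrable_norm_rpow_of_integrable_inner_rpow (by linarith) hi
  refine ⟨⟨inferInstance, hint, fun w => ?_, fun w => ?_, continuous_covForm _ _⟩, ?_, ?_⟩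
  · rw [integral_map (hm 0) (by fun_prop), integral_inner (hL2.integrable (by norm_num)), hmean,
      inner_zero_right]
  · rw [integral_map (hm 0) (by fun_prop), integral_inner_sq_eq hL2 hmean,
      dotProduct_mulVec_eq_covForm (covMatrix_isHermitian (X 0) μ)]
  · have e1 : pairMoment δ (μ.map (X 0)) (μ.map (X 0))
        = ∫ ω, |inner ℝ (X 0 ω) (X 1 ω)| ^ (2 + δ) ∂μ := by
      rw [pairMoment, ← integral_map (φ := fun ω => (X 0 ω, X 1 ω))
        (f := fun b : EuclideanSpace ℝ (Fin p) × EuclideanSpace ℝ (Fin p) =>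
          |inner ℝ b.1 b.2| ^ (2 + δ)) hm2 (by fun_prop (disch := linarith)), hpair,
        integral_prod _ hi]
      simp_rw [real_inner_comm]
    rw [e1, DConst, ← Real.rpow_mul (integral_nonneg fun ω => by positivity), one_div,
      inv_mul_cancel₀ (by linarith), Real.rpow_one, ← integral_div]
    simp_rw [ediv]
  · exact Real.rpow_nonneg (integral_nonneg fun ω => by positivity) _

end OneSample

theorem one_le_gaussMoment {δ : ℝ} (h0 : 0 ≤ δ) : 1 ≤ gaussMoment δ := by
  have hi := integrable_abs_rpow_gaussianReal (v := 1) (q := 2 + δ) (by linarith)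
  have h2 := integrable_pow_gaussianReal 1 2
  have j : Integrable (fun x : ℝ => (1 + δ / 2) * (x ^ 2 - 1)) (gaussianReal 0 1) :=
    (h2.sub (integrable_const 1)).const_mul _
  have e : ∫ x, (1 + (1 + δ / 2) * (x ^ 2 - 1)) ∂(gaussianReal 0 1) = 1 := by
    rw [integral_add (integrable_const 1) j, integral_const_mul,
      integral_sub h2 (integrable_const 1), integral_sq_gaussianReal]
    simp
  rw [← e]
  refine integral_mono ((integrable_const 1).add j) hi fun x => ?_
  have h := one_add_mul_self_le_rpow_one_add (s := x ^ 2 - 1) (by nlinarith [sq_nonneg x])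
    (p := 1 + δ / 2) (by linarith)
  refine h.trans (le_of_eq ?_)
  rw [add_sub_cancel, ← sq_abs, ← Real.rpow_natCast, ← Real.rpow_mul (abs_nonneg _)]
  congr 1; push_cast; ring

/-- This is the source of the lower bound `n^{-δ}` for `L†`, which keeps `ψ` from growing too fast.
-/
theorem one_le_dConst {δ : ℝ} (h0 : 0 ≤ δ) : 1 ≤ dConst δ := by
  have h1 : 1 ≤ √(1 + δ) := Real.one_le_sqrt.2 (by linarith)
  have h2 : 1 ≤ (∫ x, |x| ^ (2 + δ) ∂(gaussianReal 0 1)) ^ (1 / (2 + δ)) :=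
    Real.one_le_rpow (one_le_gaussMoment h0) (by positivity)
  rw [dConst]
  exact one_le_mul_of_one_le_of_one_le h1 (one_le_pow₀ h2)

/-! ### Rates -/

theorem lindebergRatio_le_Ldagger {Ω : Type*} [MeasurableSpace Ω] {p : ℕ} {μ : Measure Ω}
    [IsProbabilityMeasure μ] {δ : ℝ} (h0 : 0 ≤ δ) {X : ℕ → Ω → EuclideanSpace ℝ (Fin p)}
    (hindep : iIndepFun X μ) (hident : ∀ i, IdentDistrib (X i) (X 0) μ μ)
    (hL2 : MemLp (X 0) 2 μ) (hmean : ∫ ω, X 0 ω ∂μ = 0) (hf : covMatrix (X 0) μ ≠ 0)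
    (hD : Integrable (fun ω => |inner ℝ (X 0 ω) (X 1 ω) / frob (X 0) μ| ^ (2 + δ)) μ)
    {n : ℕ} (hn : n ≠ 0) :
    lindebergRatio δ n (frob (X 0) μ) (covForm (covMatrix_isHermitian (X 0) μ).eigenvectorBasis
        (covMatrix_isHermitian (X 0) μ).eigenvalues) (μ.map (X 0)) ≤ Ldagger δ n (X 0) (X 1) μ ∧
      ((n : ℝ) ^ δ)⁻¹ ≤ Ldagger δ n (X 0) (X 1) μ := by
  obtain ⟨hC, hpm, hD0⟩ := law_facts h0 hindep hident hL2 hmean hf hD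
  have hfp := (frob_pos (μ := μ) hf).1
  have hd := one_le_dConst h0
  have hn' : (0 : ℝ) < n := by exact_mod_cast Nat.pos_of_ne_zero hn
  set s := covForm (covMatrix_isHermitian (X 0) μ).eigenvectorBasis
    (covMatrix_isHermitian (X 0) μ).eigenvalues with hs
  have e1 : ∫ ω, ((X 0 ω).ofLp ⬝ᵥ (covMatrix (X 0) μ *ᵥ (X 0 ω).ofLp)) ^ ((2 + δ) / 2) ∂μ
      = ∫ x, s x ^ (1 + δ / 2) ∂(μ.map (X 0)) := by
    rw [integral_map (hident 0).aemeasurable_fst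
      (hC.cont.rpow_const fun x => Or.inr (by linarith)).aestronglyMeasurable]
    refine integral_congr_ae (ae_of_all _ fun ω => ?_)
    simp only
    rw [dotProduct_mulVec_eq_covForm (covMatrix_isHermitian (X 0) μ)]
    congr 1
    ring
  have hA : 0 ≤ ∫ x, s x ^ (1 + δ / 2) ∂(μ.map (X 0)) :=
    integral_nonneg fun x => Real.rpow_nonneg (hC.var_nonneg x) _
  rw [Ldagger, lindebergRatio, e1, hpm]
  constructor
  · gcongr
    linarith
  · refine le_trans ?_ (le_add_of_nonneg_left (by positivity))
    rw [inv_eq_one_div]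
    gcongr
    exact Real.one_le_rpow (by linarith) (by linarith)

/-- The exponent in `psi` is the one for which `ψ^{q+1/2} = 1/L`, so that replacement error and
concentration error coincide. -/
theorem rpow_mul_eq_of_eq_rpow {δ L : ℝ} (h0 : 0 ≤ δ) (hL : 0 < L) :
    (L ^ (-1 / (2 + δ + 1 / 2))) ^ (2 + δ) * L
      = (L ^ (-1 / (2 + δ + 1 / 2))) ^ (-(1 / 2) : ℝ) := by
  rw [← Real.rpow_mul hL.le, ← Real.rpow_mul hL.le]
  nth_rewrite 2 [← Real.rpow_one L]
  rw [← Real.rpow_add hL]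
  congr 1
  have : 2 + δ + 1 / 2 ≠ 0 := by positivity
  field_simp
  ring

/-- Equivalent to `ψ^{3/2} ≤ √n`. The lower bound on `L` gives `ψ^{3/2} ≤ n^e` with `e = (3δ/2)/(5/2
+ δ)`, and `e ≤ 1/2` because `δ ≤ 1`. -/
theorem div_sqrt_le_of_eq_rpow {δ L : ℝ} (h0 : 0 ≤ δ) (h1 : δ ≤ 1) {n : ℕ} (hn : n ≠ 0)
    (hL : ((n : ℝ) ^ δ)⁻¹ ≤ L) :
    L ^ (-1 / (2 + δ + 1 / 2)) / √n ≤ (L ^ (-1 / (2 + δ + 1 / 2))) ^ (-(1 / 2) : ℝ) := by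
  have hn1 : (1 : ℝ) ≤ n := by exact_mod_cast Nat.one_le_iff_ne_zero.2 hn
  have hn' : (0 : ℝ) < n := by linarith
  have hLp : 0 < L := lt_of_lt_of_le (by positivity) hL
  set ψ := L ^ (-1 / (2 + δ + 1 / 2)) with hψ
  have hψ0 : 0 < ψ := by positivity
  have hr : 0 < 2 + δ + 1 / 2 := by positivity
  have b1 : ψ ^ (3 / 2 : ℝ) ≤ √n := by
    calc ψ ^ (3 / 2 : ℝ) = L ^ (-1 / (2 + δ + 1 / 2) * (3 / 2)) := by
          rw [hψ, ← Real.rpow_mul hLp.le]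
      _ ≤ (((n : ℝ) ^ δ)⁻¹) ^ (-1 / (2 + δ + 1 / 2) * (3 / 2)) := by
          refine Real.rpow_le_rpow_of_nonpos (by positivity) hL ?_
          exact mul_nonpos_of_nonpos_of_nonneg
            (div_nonpos_of_nonpos_of_nonneg (by norm_num) hr.le) (by norm_num)
      _ = (n : ℝ) ^ (δ * (1 / (2 + δ + 1 / 2) * (3 / 2))) := by
          rw [← Real.rpow_neg hn'.le, ← Real.rpow_mul hn'.le]
          congr 1
          ring
      _ ≤ (n : ℝ) ^ (1 / 2 : ℝ) := by
          refine Real.rpow_le_rpow_of_exponent_le hn1 ?_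
          rw [show δ * (1 / (2 + δ + 1 / 2) * (3 / 2)) = (3 * δ / 2) / (2 + δ + 1 / 2) by ring,
            div_le_iff₀ hr]
          linarith
      _ = √n := (Real.sqrt_eq_rpow _).symm
  have hsq : 0 < √(n : ℝ) := Real.sqrt_pos.2 hn'
  rw [div_le_iff₀ hsq]
  calc ψ = ψ ^ (-(1 / 2) : ℝ) * ψ ^ (3 / 2 : ℝ) := by
        rw [← Real.rpow_add hψ0]; norm_num
    _ ≤ ψ ^ (-(1 / 2) : ℝ) * √n := by gcongr

theorem exists_kolmogorovDist_le {δ : ℝ} (h0 : 0 ≤ δ) (h1 : δ ≤ 1) : ∃ C : ℝ, 0 < C ∧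
    ∀ {Ω : Type*} [MeasurableSpace Ω] {p : ℕ} {μ : Measure Ω} [IsProbabilityMeasure μ]
      {X : ℕ → Ω → EuclideanSpace ℝ (Fin p)}, iIndepFun X μ →
      (∀ i, IdentDistrib (X i) (X 0) μ μ) → MemLp (X 0) 2 μ → ∫ ω, X 0 ω ∂μ = 0 →
      covMatrix (X 0) μ ≠ 0 →
      Integrable (fun ω => |inner ℝ (X 0 ω) (X 1 ω) / frob (X 0) μ| ^ (2 + δ)) μ →
      ∀ {n : ℕ}, 2 ≤ n →
        kolmogorovDist n X μ ≤ C * psi δ n (X 0) (X 1) μ ^ (-(1 / 2) : ℝ) := by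
  obtain ⟨C, hC, hbound⟩ := exists_kolmogorov_bound h0 h1
  -- Each of the three error terms is at most `ψ^{-1/2}`.
  refine ⟨C * 3, by positivity, ?_⟩
  intro Ω _ p μ _ X hindep hident hL2 hmean hf hD n hn
  have hn0 : n ≠ 0 := by omega
  obtain ⟨hcv, -, -⟩ := law_facts h0 hindep hident hL2 hmean hf hD
  obtain ⟨hle, hge⟩ := lindebergRatio_le_Ldagger h0 hindep hident hL2 hmean hf hD hn0
  have hn' : (0 : ℝ) < n := by exact_mod_cast Nat.pos_of_ne_zero hn0
  have hLp : 0 < Ldagger δ n (X 0) (X 1) μ := lt_of_lt_of_le (by positivity) hge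
  have hψ : 0 < psi δ n (X 0) (X 1) μ := Real.rpow_pos_of_pos hLp _
  obtain ⟨hfp, hf2⟩ := frob_pos (μ := μ) hf
  -- An eigenvalue is the variance of the projection of `X 0` on its unit eigenvector.
  have hl : ∀ j, 0 ≤ (covMatrix_isHermitian (X 0) μ).eigenvalues j := fun j => by
    have := hcv.var_nonneg ((covMatrix_isHermitian (X 0) μ).eigenvectorBasis j)
    rw [← dotProduct_mulVec_eq_covForm (covMatrix_isHermitian (X 0) μ),
      (covMatrix_isHermitian (X 0) μ).mulVec_eigenvectorBasis, dotProduct_smul,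
      ← inner_eq_dotProduct, real_inner_self_eq_norm_sq,
      (covMatrix_isHermitian (X 0) μ).eigenvectorBasis.norm_eq_one] at this
    simpa using this
  refine ciSup_le fun t => ?_
  rw [measureReal_Rtilde_le hindep hident n t, lawV_real_Iic]
  refine (hbound (Fin p) (EuclideanSpace ℝ (Fin p)) _ _ _ _ n _ t hl hfp hf2 hcv hn hψ).trans ?_
  have r1 : psi δ n (X 0) (X 1) μ ^ (2 + δ) * Ldagger δ n (X 0) (X 1) μ
    = psi δ n (X 0) (X 1) μ ^ (-(1 / 2) : ℝ) := rpow_mul_eq_of_eq_rpow h0 hLp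
  have r2 : psi δ n (X 0) (X 1) μ / √n ≤ psi δ n (X 0) (X 1) μ ^ (-(1 / 2) : ℝ) :=
    div_sqrt_le_of_eq_rpow h0 h1 hn0 hge
  have r3 := mul_le_mul_of_nonneg_left hle (by positivity : 0 ≤ psi δ n (X 0) (X 1) μ ^ (2 + δ))
  rw [mul_assoc]
  gcongr
  linarith

end UStat

/-! ### The main theorem. -/

theorem mainTheorem2 (δ : ℝ) (hδ : 0 < δ) (hδ1 : δ ≤ 1)
    (p : ℕ → ℕ) (Ω : ℕ → Type*) [∀ n, MeasurableSpace (Ω n)]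
    (μ : ∀ n, Measure (Ω n)) [∀ n, IsProbabilityMeasure (μ n)]
    -- for each `n`, an i.i.d. sequence of random vectors in `ℝ^{p n}`
    (X : ∀ n, ℕ → Ω n → EuclideanSpace ℝ (Fin (p n)))
    (hindep : ∀ n, iIndepFun (X n) (μ n))
    (hident : ∀ n i, IdentDistrib (X n i) (X n 0) (μ n) (μ n))
    -- with mean `0` and a (finite and nonzero) covariance matrix
    (hL2 : ∀ n, MemLp (X n 0) 2 (μ n))
    (hmean : ∀ n, ∫ ω, X n 0 ω ∂(μ n) = 0)
    (hf : ∀ n, UStat.covMatrix (X n 0) (μ n) ≠ 0)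
    -- `D_δ < ∞`
    (hD : ∀ n, Integrable
      (fun ω => |inner ℝ (X n 0 ω) (X n 1 ω) / UStat.frob (X n 0) (μ n)| ^ (2 + δ)) (μ n))
    (hL : Tendsto (fun n => UStat.Ldagger δ n (X n 0) (X n 1) (μ n)) atTop (𝓝 0)) :
    Tendsto (fun n => UStat.psi δ n (X n 0) (X n 1) (μ n)) atTop atTop ∧
    (fun n => UStat.kolmogorovDist n (X n) (μ n))
      =O[atTop] (fun n => UStat.psi δ n (X n 0) (X n 1) (μ n) ^ (-(1 / 2) : ℝ)) ∧
    Tendsto (fun n => UStat.psi δ n (X n 0) (X n 1) (μ n) ^ (-(1 / 2) : ℝ)) atTop (𝓝 0) ∧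
    Tendsto (fun n => UStat.kolmogorovDist n (X n) (μ n)) atTop (𝓝 0) := by
  have hLpos : ∀ᶠ n in atTop, 0 < UStat.Ldagger δ n (X n 0) (X n 1) (μ n) := by
    -- At `n = 0` both denominators in `Ldagger` vanish and its value is `0`.
    filter_upwards [eventually_ne_atTop 0] with n hn
    have hn' : (0 : ℝ) < n := by exact_mod_cast Nat.pos_of_ne_zero hn
    exact lt_of_lt_of_le (by positivity) (UStat.lindebergRatio_le_Ldagger hδ.le (hindep n)
      (hident n) (hL2 n) (hmean n) (hf n) (hD n) hn).2
  have hexp : -1 / (2 + δ + 1 / 2) < 0 := div_neg_of_neg_of_pos (by norm_num) (by positivity)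
  have hψ : Tendsto (fun n => UStat.psi δ n (X n 0) (X n 1) (μ n)) atTop atTop :=
    (tendsto_rpow_neg_nhdsGT_zero hexp).comp
      (tendsto_nhdsWithin_iff.2 ⟨hL, hLpos⟩)
  have hψ0 : Tendsto (fun n => UStat.psi δ n (X n 0) (X n 1) (μ n) ^ (-(1 / 2) : ℝ)) atTop
      (𝓝 0) := (tendsto_rpow_neg_atTop (by norm_num)).comp hψ
  obtain ⟨C, hCpos, hC⟩ := UStat.exists_kolmogorovDist_le hδ.le hδ1
  have hO : (fun n => UStat.kolmogorovDist n (X n) (μ n))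
      =O[atTop] (fun n => UStat.psi δ n (X n 0) (X n 1) (μ n) ^ (-(1 / 2) : ℝ)) := by
    refine IsBigO.of_bound C ?_
    filter_upwards [eventually_ge_atTop 2] with n hn
    have hnn : 0 ≤ UStat.kolmogorovDist n (X n) (μ n) := Real.iSup_nonneg fun t => abs_nonneg _
    rw [Real.norm_of_nonneg hnn]
    refine (hC (hindep n) (hident n) (hL2 n) (hmean n) (hf n) (hD n) hn).trans ?_
    exact mul_le_mul_of_nonneg_left (Real.le_norm_self _) hCpos.le
  exact ⟨hψ, hO, hψ0, hO.trans_tendsto hψ0⟩
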